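/- Let $B$ be a unital $C^*$-algebra, $A\subseteq B$ a $C^*$-subalgebra containing the unit of $B$, and $E:B\to A$ a conditional expectation of index-finite type with Watatani index $\operatorname{Index}E=2$; that is, there are finitely many pairs $(x_i,y_i)\in B\times B$ (a quasi-basis) with $b=\sum_i x_iE(y_ib)=\sum_i E(bx_i)y_i$ for all $b\in B$, and $\sum_i x_iy_i=2$. Let $e_A$ be the Jones projection $b\mapsto E(b)$ on the right Hilbert $A$-module $B$ with inner product $E(x^*y)$, and let $C^*\langle B,e_A\rangle$ be the basic construction, i.e. the closed linear span of the operators $be_Ac$ ($b,c\in B$). Let $\widehat\beta$ be the automorphism of $C^*\langle B,e_A\rangle$ that fixes $B$ pointwise and sends $e_A$ to $1-e_A$. Let $X_B=e_AC^*\langle B,e_A\rangle(1-e_A)$ with $a\cdot x\cdot b=axb$, left inner product ${}_A\langle x,y\rangle=a$ where $ae_A=xy^*$, right inner product $\langle x,y\rangle_A=a$ where $a(1-e_A)=x^*y$, and involution $x^\sharp=\widehat\beta(x^*)$. A $2\mathbb Z$-inner $C^*$-dynamical system $(A,\mathbb Z,\alpha)$ consists of an automorphism $\alpha$ of $A$ and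 a unitary $z\in A$ with $\alpha(z)=z$ and $\alpha^2=\operatorname{Ad}(z)$. For such a system let $X_\alpha$ be the vector space $A$ with $a\cdot x\cdot b=ax\alpha(b)$, ${}_A\langle x,y\rangle=xy^*$, $\langle x,y\rangle_A=\alpha^{-1}(x^*y)$ and $x^\sharp=z^*\alpha(x^*)$. Green's restricted crossed product $A\rtimes_{\alpha/2\mathbb Z}\mathbb Z$ is the enveloping $C^*$-algebra of the $*$-algebra of functions $f:\mathbb Z\to A$ with $f(n-2m)=f(n)z^m$, with product $(fg)(n)=\sum_{k\in\{0,1\}}f(k)\alpha^k(g(n-k))$ and involution $f^*(n)=\alpha^n(f(-n)^*)$; $A$ is embedded as the functions supported on $2\mathbb Z$, through the value at $0$, and the canonical conditional expectation is $f\mapsto f(0)$. Then $X_B$ and every $X_\alpha$ are involutive $A$-$A$-equivalence bimodules, and the following conditions are equivalent: 1. $e_A$ and $1-e_A$ are Murray–von Neumann equivalent in $C^*\langle B,e_A\rangle$; 2. there is a unitary $u\in B$ such that $\{(1,1),(u,u^*)\}$ is a quasi-basis for $E$; 3. there is a $2\mathbb Z$-inner $C^*$-dynamical system $(A,\mathbb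 Z,\alpha)$ such that $X_\alpha\cong X_B$ as involutive $A$-$A$-equivalence bimodules. Moreover, for every $2\mathbb Z$-inner system $(A,\mathbb Z,\alpha)$ with $X_\alpha\cong X_B$ there is an isomorphism of $A\rtimes_{\alpha/2\mathbb Z}\mathbb Z$ onto $B$ that is the identity on $A$ and carries the canonical conditional expectation to $E$. -/

import Mathlib

universe u

namespace IndexTwo

noncomputable section

/-! ## Conditional expectations of index-finite type -/

section Expectation

variable {B : Type u} [CStarAlgebra B]

/-- A conditional expectation of the unital C⋆-algebra `B` onto the unital C⋆-subalgebra `A`: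
a positive linear idempotent `A`-bimodule map of `B` onto `A`. -/
structure CondExp (A : StarSubalgebra ℂ B) extends B →ₗ[ℂ] A where
  map_coe : ∀ a : A, toFun (a : B) = a
  map_coe_mul : ∀ (a : A) (b : B), toFun (a * b) = a * toFun b
  map_mul_coe : ∀ (b : B) (a : A), toFun (b * a) = toFun b * a
  map_star_mul_self : ∀ b : B, ∃ c : A, toFun (star b * b) = star c * c

instance (A : StarSubalgebra ℂ B) : CoeFun (CondExp A) (fun _ => B → A) :=
  ⟨fun E => E.toLinearMap⟩

variable {A : StarSubalgebra ℂ B}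

/-- A finite family of pairs `(x i, y i)` is a quasi-basis for `E` if
`b = ∑ x i E(y i b) = ∑ E(b x i) y i` for every `b`. -/
def CondExp.IsQuasiBasis (E : CondExp A) {ι : Type} [Fintype ι] (x y : ι → B) : Prop :=
  ∀ b : B, ∑ i, x i * (E (y i * b) : B) = b ∧ ∑ i, (E (b * x i) : B) * y i = b

/-- `E` is of index-finite type (it has a finite quasi-basis) and its Watatani index
`∑ x i * y i` is `c`. -/
def CondExp.HasIndex (E : CondExp A) (c : B) : Prop :=
  ∃ (n : ℕ) (x y : Fin n → B), E.IsQuasiBasis x y ∧ ∑ i, x i * y i = c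

/-- The index does not depend on the quasi-basis. -/
theorem CondExp.HasIndex.unique {E : CondExp A} {c d : B} (hc : E.HasIndex c)
    (hd : E.HasIndex d) : c = d := by
  obtain ⟨n, x, y, h, rfl⟩ := hc
  obtain ⟨m, x', y', h', rfl⟩ := hd
  calc ∑ i, x i * y i = ∑ i, ∑ j, x i * ((E (y i * x' j) : B) * y' j) := by
        refine Finset.sum_congr rfl fun i _ => ?_
        rw [← Finset.mul_sum, (h' (y i)).2]
    _ = ∑ j, (∑ i, x i * (E (y i * x' j) : B)) * y' j := by
        rw [Finset.sum_comm]
        refine Finset.sum_congr rfl fun j _ => ?_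
        rw [Finset.sum_mul]
        exact Finset.sum_congr rfl fun i _ => (mul_assoc _ _ _).symm
    _ = ∑ j, x' j * y' j := Finset.sum_congr rfl fun j _ => by rw [(h (x' j)).1]

theorem CondExp.map_star (E : CondExp A) (b : B) : E (star b) = star (E b) := by
  have hsa : ∀ x : B, star (E (star x * x)) = E (star x * x) := fun x => by
    obtain ⟨c, hc⟩ := E.map_star_mul_self x
    change star (E.toFun _) = E.toFun _
    rw [hc]; simp
  have h0 := hsa 1
  have hb := hsa b
  have h1 := hsa (1 + b)
  have h2 := hsa (1 + Complex.I • b)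
  simp only [star_add, star_one, add_mul, mul_add, one_mul, mul_one, map_add, star_smul,
    smul_mul_assoc, mul_smul_comm, map_smul, hb] at h0 h1 h2
  rw [h0] at h1 h2
  have e1 : star (E b) + star (E (star b)) = E b + E (star b) := by
    rw [← sub_eq_zero] at h1 ⊢
    rw [← h1]; abel
  have e2 : -(star (E b)) + star (E (star b)) = E b - E (star b) := by
    have := congrArg (fun t => -Complex.I • t) h2
    simp only [smul_add, smul_smul, Complex.star_def, Complex.conj_I, map_neg, neg_mul, smul_neg, neg_neg,
      Complex.I_mul_I, one_smul, neg_smul] at this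
    rw [← sub_eq_zero] at this ⊢
    rw [← this]; abel
  have e3 : (2 : ℂ) • E (star b) = (2 : ℂ) • star (E b) := by
    rw [two_smul, two_smul]
    rw [← sub_eq_zero] at e1 e2 ⊢
    refine Eq.trans ?_ ((congrArg₂ HSub.hSub e2 e1).trans (sub_zero _))
    abel
  exact smul_right_injective _ (two_ne_zero) e3


/-- The square of the norm of `b` in the right pre-Hilbert `A`-module `B` with the inner product
`⟨x, y⟩ = E(x⋆ y)`. -/
def CondExp.normSq (E : CondExp A) (b : B) : ℝ := ‖E (star b * b)‖

theorem norm_le_of_star_mul_self {D : Type u} [CStarAlgebra D] {p q : D}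
    (hp : ∃ c, p = star c * c) (hq : ∃ c, q = star c * c) : ‖p‖ ≤ ‖p + q‖ := by
  let _ : PartialOrder D := CStarAlgebra.spectralOrder D
  have _ : StarOrderedRing D := CStarAlgebra.spectralOrderedRing D
  obtain ⟨c, rfl⟩ := hp
  obtain ⟨d, rfl⟩ := hq
  exact CStarAlgebra.norm_le_norm_of_nonneg_of_le (star_mul_self_nonneg c)
    (le_add_of_nonneg_right (star_mul_self_nonneg d))

theorem exists_defect {D : Type u} [CStarAlgebra D] (b : D) :
    ∃ c : D, star b * b + star c * c = ((‖b‖ ^ 2 : ℝ) : ℂ) • (1 : D) := by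
  let _ : PartialOrder D := CStarAlgebra.spectralOrder D
  have _ : StarOrderedRing D := CStarAlgebra.spectralOrderedRing D
  have h : star b * b ≤ algebraMap ℝ D (‖b‖ ^ 2) := CStarAlgebra.star_mul_le_algebraMap_norm_sq
  obtain ⟨c, hc⟩ := CStarAlgebra.nonneg_iff_eq_star_mul_self.mp (sub_nonneg.mpr h)
  refine ⟨c, ?_⟩
  rw [← hc, add_sub_cancel, Algebra.algebraMap_eq_smul_one, Complex.coe_smul]

variable (E : CondExp A)

theorem CondExp.normSq_add_le [IsClosed (A : Set B)] (x y : B) :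
    E.normSq (x + y) ≤ 2 * E.normSq x + 2 * E.normSq y := by
  have h := norm_le_of_star_mul_self (D := A) (E.map_star_mul_self (x + y))
    (E.map_star_mul_self (x - y))
  refine h.trans ?_
  have e : E (star (x + y) * (x + y)) + E (star (x - y) * (x - y))
      = (2 : ℂ) • E (star x * x) + (2 : ℂ) • E (star y * y) := by
    rw [← map_add, ← map_smul, ← map_smul, ← map_add]
    congr 1
    rw [two_smul, two_smul, star_add, star_sub]
    noncomm_ring
  change ‖E (star (x + y) * (x + y)) + E (star (x - y) * (x - y))‖ ≤ _
  rw [e]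
  refine (norm_add_le _ _).trans (le_of_eq ?_)
  simp [norm_smul, CondExp.normSq]

theorem CondExp.normSq_smul (c : ℂ) (x : B) : E.normSq (c • x) = ‖c‖ ^ 2 * E.normSq x := by
  simp only [CondExp.normSq, star_smul, smul_mul_assoc, mul_smul_comm, map_smul, norm_smul,
    norm_star]
  ring

theorem CondExp.normSq_mul_le [IsClosed (A : Set B)] (b x : B) : E.normSq (b * x) ≤ ‖b‖ ^ 2 * E.normSq x := by
  obtain ⟨c, hc⟩ := exists_defect b
  have h := norm_le_of_star_mul_self (D := A) (E.map_star_mul_self (b * x))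
    (E.map_star_mul_self (c * x))
  refine h.trans (le_of_eq ?_)
  change ‖E (star (b * x) * (b * x)) + E (star (c * x) * (c * x))‖ = _
  have e : star (b * x) * (b * x) + star (c * x) * (c * x)
      = ((‖b‖ ^ 2 : ℝ) : ℂ) • (star x * x) := by
    calc _ = star x * (star b * b + star c * c) * x := by
          rw [star_mul, star_mul]; noncomm_ring
      _ = _ := by rw [hc]; simp
  rw [← map_add, e, map_smul, norm_smul]
  simp [CondExp.normSq]

/-! ## The C⋆-basic construction -/

/-- The ring of pairs `(T, op S)` of linear maps on `B` with `⟨T x, y⟩ = ⟨x, S y⟩`, where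
`⟨x, y⟩ = E(x⋆ y)`. -/
def CondExp.adjointPairs :
    Subring (Module.End ℂ B × (Module.End ℂ B)ᵐᵒᵖ) where
  carrier := {p | ∀ x y : B, E (star (p.1 x) * y) = E (star x * p.2.unop y)}
  mul_mem' := fun {p q} hp hq x y => by
    change E (star (p.1 (q.1 x)) * y) = E (star x * q.2.unop (p.2.unop y))
    rw [hp, hq]
  one_mem' := fun x y => rfl
  add_mem' := fun {p q} hp hq x y => by
    change E (star (p.1 x + q.1 x) * y) = E (star x * (p.2.unop y + q.2.unop y))
    rw [star_add, add_mul, mul_add, map_add, map_add, hp, hq]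
  zero_mem' := fun x y => by
    change E (star (0 : B) * y) = E (star x * (0 : B))
    simp
  neg_mem' := fun {p} hp x y => by
    change E (star (-(p.1 x)) * y) = E (star x * (-(p.2.unop y)))
    rw [star_neg, neg_mul, mul_neg, map_neg, map_neg, hp]

/-- The ⋆-algebra of adjointable operators on the right Hilbert `A`-module `B` with inner product
`⟨x, y⟩ = E(x⋆ y)`, an operator being kept together with its adjoint. When `E` is of
index-finite type, `E` is faithful and `B` is complete in the module norm, so that the adjoint is
unique and this is the C⋆-algebra of all adjointable operators. -/
def CondExp.Adjointable : Type u := E.adjointPairs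

namespace CondExp.Adjointable

variable {E}

instance : Ring E.Adjointable := inferInstanceAs (Ring E.adjointPairs)

/-- The underlying operator on `B`. -/
def op (T : E.Adjointable) : B →ₗ[ℂ] B := T.1.1

/-- The adjoint operator on `B`. -/
def adj (T : E.Adjointable) : B →ₗ[ℂ] B := T.1.2.unop

theorem inner_op (T : E.Adjointable) (x y : B) :
    E (star (T.op x) * y) = E (star x * T.adj y) := T.2 x y

@[ext] theorem ext {S T : E.Adjointable} (h : S.op = T.op) (h' : S.adj = T.adj) : S = T :=
  Subtype.ext (Prod.ext h (MulOpposite.unop_injective h'))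

/-- The adjointable operator with given action and adjoint. -/
def mk (T S : B →ₗ[ℂ] B) (h : ∀ x y, E (star (T x) * y) = E (star x * S y)) : E.Adjointable :=
  ⟨(T, MulOpposite.op S), h⟩

@[simp] theorem op_mk (T S : B →ₗ[ℂ] B) (h) : (mk T S h : E.Adjointable).op = T := rfl
@[simp] theorem adj_mk (T S : B →ₗ[ℂ] B) (h) : (mk T S h : E.Adjointable).adj = S := rfl
@[simp] theorem op_add (S T : E.Adjointable) : (S + T).op = S.op + T.op := rfl
@[simp] theorem adj_add (S T : E.Adjointable) : (S + T).adj = S.adj + T.adj := rfl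
@[simp] theorem op_sub (S T : E.Adjointable) : (S - T).op = S.op - T.op := rfl
@[simp] theorem adj_sub (S T : E.Adjointable) : (S - T).adj = S.adj - T.adj := rfl
@[simp] theorem op_zero : (0 : E.Adjointable).op = 0 := rfl
@[simp] theorem adj_zero : (0 : E.Adjointable).adj = 0 := rfl
@[simp] theorem op_one : (1 : E.Adjointable).op = LinearMap.id := rfl
@[simp] theorem adj_one : (1 : E.Adjointable).adj = LinearMap.id := rfl
@[simp] theorem op_mul (S T : E.Adjointable) : (S * T).op = S.op ∘ₗ T.op := rfl
@[simp] theorem adj_mul (S T : E.Adjointable) : (S * T).adj = T.adj ∘ₗ S.adj := rfl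

instance : Star E.Adjointable :=
  ⟨fun T => mk T.adj T.op fun x y => by
    rw [← star_star (star (T.adj x) * y), E.map_star, star_mul, star_star, ← inner_op,
      ← E.map_star, star_mul, star_star]⟩

@[simp] theorem op_star (T : E.Adjointable) : (star T).op = T.adj := rfl
@[simp] theorem adj_star (T : E.Adjointable) : (star T).adj = T.op := rfl

instance : StarRing E.Adjointable where
  star_involutive _ := rfl
  star_mul _ _ := rfl
  star_add _ _ := rfl

instance : SMul ℂ E.Adjointable :=
  ⟨fun c T => mk (c • T.op) (star c • T.adj) fun x y => by
    simp only [LinearMap.smul_apply, star_smul, smul_mul_assoc, mul_smul_comm, map_smul,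
      inner_op]⟩

@[simp] theorem op_smul (c : ℂ) (T : E.Adjointable) : (c • T).op = c • T.op := rfl
@[simp] theorem adj_smul (c : ℂ) (T : E.Adjointable) : (c • T).adj = star c • T.adj := rfl

instance : Module ℂ E.Adjointable where
  one_smul T := by ext <;> simp
  mul_smul c d T := by ext <;> simp [mul_smul]
  smul_zero c := by ext <;> simp
  smul_add c S T := by ext <;> simp
  add_smul c d T := by ext <;> simp [add_smul]
  zero_smul T := by ext <;> simp

instance : Algebra ℂ E.Adjointable :=
  Algebra.ofModule (fun c S T => by ext <;> simp) (fun c S T => by ext <;> simp)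

instance : StarModule ℂ E.Adjointable :=
  ⟨fun c T => by ext <;> simp⟩

end CondExp.Adjointable

/-- Left multiplication by `b`, the embedding of `B` into the adjointable operators. -/
def CondExp.leftMul (b : B) : E.Adjointable :=
  Adjointable.mk (LinearMap.mulLeft ℂ b) (LinearMap.mulLeft ℂ (star b)) fun x y => by
    simp [mul_assoc]

/-- The Jones projection `e_A : b ↦ E(b)`. -/
def CondExp.jones : E.Adjointable :=
  Adjointable.mk (A.toSubalgebra.val.toLinearMap ∘ₗ E.toLinearMap)
    (A.toSubalgebra.val.toLinearMap ∘ₗ E.toLinearMap) fun x y => by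
    change E (star ((E x : A) : B) * y) = E (star x * ((E y : A) : B))
    rw [← StarMemClass.coe_star]
    exact (E.map_coe_mul (star (E x)) y).trans
      (by rw [← E.map_star]; exact (E.map_mul_coe (star x) (E y)).symm)

/-- The linear span of the operators `b e_A c` with `b` and `c` in `B`. -/
def CondExp.basicSpan : Submodule ℂ E.Adjointable :=
  Submodule.span ℂ {T | ∃ b c : B, T = E.leftMul b * E.jones * E.leftMul c}

/-- The C⋆-basic construction `C⋆⟨B, e_A⟩`: the closure, in the operator norm of the Hilbert
module, of the linear span of the operators `b e_A c`. -/
def CondExp.basicConstruction [IsClosed (A : Set B)] : Submodule ℂ E.Adjointable where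
  carrier := {T | ∀ ε : ℝ, 0 < ε → ∃ S ∈ E.basicSpan, ∀ x : B,
    E.normSq ((T - S).op x) ≤ ε ^ 2 * E.normSq x}
  zero_mem' := fun ε _ => ⟨0, Submodule.zero_mem _, fun x => by
    simp only [sub_zero, Adjointable.op_zero, LinearMap.zero_apply]
    have : E.normSq 0 = 0 := by simp [CondExp.normSq]
    rw [this]
    exact mul_nonneg (sq_nonneg _) (norm_nonneg _)⟩
  add_mem' := fun {T T'} hT hT' ε hε => by
    obtain ⟨S, hS, h⟩ := hT (ε / 2) (by positivity)
    obtain ⟨S', hS', h'⟩ := hT' (ε / 2) (by positivity)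
    refine ⟨S + S', Submodule.add_mem _ hS hS', fun x => ?_⟩
    have e : (T + T' - (S + S')).op x = (T - S).op x + (T' - S').op x := by
      simp; abel
    rw [e]
    refine (E.normSq_add_le _ _).trans ?_
    have := h x
    have := h' x
    nlinarith
  smul_mem' := fun c T hT ε hε => by
    obtain ⟨S, hS, h⟩ := hT (ε / (‖c‖ + 1)) (by positivity)
    refine ⟨c • S, Submodule.smul_mem _ c hS, fun x => ?_⟩
    rw [← smul_sub, Adjointable.op_smul, LinearMap.smul_apply, E.normSq_smul]
    calc ‖c‖ ^ 2 * E.normSq ((T - S).op x)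
        ≤ ‖c‖ ^ 2 * ((ε / (‖c‖ + 1)) ^ 2 * E.normSq x) := by gcongr; exact h x
      _ = (‖c‖ * (ε / (‖c‖ + 1))) ^ 2 * E.normSq x := by ring
      _ ≤ ε ^ 2 * E.normSq x := by
          have h1 : ‖c‖ * (ε / (‖c‖ + 1)) ≤ ε := by
            rw [← mul_div_assoc, div_le_iff₀ (by positivity)]
            nlinarith [norm_nonneg c]
          have h0 : 0 ≤ E.normSq x := norm_nonneg _
          gcongr

theorem CondExp.leftMul_mul (b c : B) : E.leftMul (b * c) = E.leftMul b * E.leftMul c := by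
  ext x
  · exact mul_assoc b c x
  · change star (b * c) * x = star c * (star b * x)
    rw [star_mul, mul_assoc]

theorem CondExp.leftMul_one : E.leftMul 1 = 1 := by
  ext x
  · exact one_mul x
  · change star (1 : B) * x = x
    simp

theorem CondExp.commute_jones (a : A) : E.leftMul a * E.jones = E.jones * E.leftMul a := by
  ext x
  · exact congrArg Subtype.val (E.map_coe_mul a x).symm
  · exact congrArg Subtype.val (E.map_coe_mul (star a) x)

theorem CondExp.basicSpan_le [IsClosed (A : Set B)] : E.basicSpan ≤ E.basicConstruction :=
  fun T hT ε _ => ⟨T, hT, fun x => by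
    have h : E.normSq ((T - T).op x) = 0 := by simp [CondExp.normSq]
    rw [h]
    exact mul_nonneg (sq_nonneg _) (norm_nonneg _)⟩

theorem CondExp.leftMul_mul_mem_span (b : B) {T : E.Adjointable} (hT : T ∈ E.basicSpan) :
    E.leftMul b * T ∈ E.basicSpan := by
  have h : E.basicSpan ≤ E.basicSpan.comap (LinearMap.mulLeft ℂ (E.leftMul b)) :=
    Submodule.span_le.mpr (by
      rintro _ ⟨c, d, rfl⟩
      exact Submodule.subset_span ⟨b * c, d, by simp [E.leftMul_mul, mul_assoc]⟩)
  exact h hT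

theorem CondExp.mul_leftMul_mem_span (b : B) {T : E.Adjointable} (hT : T ∈ E.basicSpan) :
    T * E.leftMul b ∈ E.basicSpan := by
  have h : E.basicSpan ≤ E.basicSpan.comap (LinearMap.mulRight ℂ (E.leftMul b)) :=
    Submodule.span_le.mpr (by
      rintro _ ⟨c, d, rfl⟩
      exact Submodule.subset_span ⟨c, d * b, by simp [E.leftMul_mul, mul_assoc]⟩)
  exact h hT

theorem CondExp.scale_aux {ε r m : ℝ} (hε : 0 < ε) (hr : 0 ≤ r) (hm : 0 ≤ m) :
    r ^ 2 * ((ε / (r + 1)) ^ 2 * m) ≤ ε ^ 2 * m := by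
  have h1 : r * (ε / (r + 1)) ≤ ε := by
    rw [← mul_div_assoc, div_le_iff₀ (by positivity)]
    nlinarith
  calc r ^ 2 * ((ε / (r + 1)) ^ 2 * m) = (r * (ε / (r + 1))) ^ 2 * m := by ring
    _ ≤ ε ^ 2 * m := by gcongr

theorem CondExp.leftMul_mul_mem [IsClosed (A : Set B)] (b : B) {T : E.Adjointable}
    (hT : T ∈ E.basicConstruction) : E.leftMul b * T ∈ E.basicConstruction := fun ε hε => by
  obtain ⟨S, hS, h⟩ := hT (ε / (‖b‖ + 1)) (by positivity)
  refine ⟨_, E.leftMul_mul_mem_span b hS, fun x => ?_⟩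
  rw [← mul_sub]
  exact (E.normSq_mul_le b _).trans ((mul_le_mul_of_nonneg_left (h x) (sq_nonneg _)).trans
    (CondExp.scale_aux hε (norm_nonneg b) (norm_nonneg _)))

theorem CondExp.mul_leftMul_mem [IsClosed (A : Set B)] (b : B) {T : E.Adjointable}
    (hT : T ∈ E.basicConstruction) : T * E.leftMul b ∈ E.basicConstruction := fun ε hε => by
  obtain ⟨S, hS, h⟩ := hT (ε / (‖b‖ + 1)) (by positivity)
  refine ⟨_, E.mul_leftMul_mem_span b hS, fun x => ?_⟩
  rw [← sub_mul]
  refine (h (b * x)).trans ?_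
  refine (mul_le_mul_of_nonneg_left (E.normSq_mul_le b x) (sq_nonneg _)).trans ?_
  rw [mul_left_comm]
  exact CondExp.scale_aux hε (norm_nonneg b) (norm_nonneg _)

theorem CondExp.jones_mul_jones : E.jones * E.jones = E.jones := by
  ext x
  · exact congrArg Subtype.val (E.map_coe (E x))
  · exact congrArg Subtype.val (E.map_coe (E x))

/-- Murray-von Neumann equivalence of two projections in `C⋆⟨B, e_A⟩`. -/
def CondExp.MvNEquivalent [IsClosed (A : Set B)] (p q : E.Adjointable) : Prop :=
  ∃ v ∈ E.basicConstruction, star v * v = p ∧ v * star v = q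

/-- The self-adjoint unitary `U = 2 e_A - 1`. -/
def CondExp.symmetry : E.Adjointable := 2 * E.jones - 1

open Classical in
/-- The dual automorphism `b₁ + b₂ U ↦ b₁ - b₂ U` of `C⋆⟨B, e_A⟩`, which fixes `B` pointwise and
sends `e_A` to `1 - e_A`. When the index of `E` is `2`, each element of `C⋆⟨B, e_A⟩` has exactly
one decomposition `b₁ + b₂ U`; operators without a decomposition are sent to `0`. -/
def CondExp.dualAut (T : E.Adjointable) : E.Adjointable :=
  if h : ∃ p : B × B, T = E.leftMul p.1 + E.leftMul p.2 * E.symmetry then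
    E.leftMul h.choose.1 - E.leftMul h.choose.2 * E.symmetry
  else 0

end Expectation

/-! ## Involutive equivalence bimodules -/

section Bimodules

/-- The data carried by an involutive `A`-`A`-equivalence bimodule: a complex vector space with a
left and a right action of `A`, a left and a right `A`-valued inner product, and an involution. -/
structure BimoduleData (A : Type u) [CStarAlgebra A] where
  carrier : Type u
  [addCommGroup : AddCommGroup carrier]
  [module : Module ℂ carrier]
  /-- the left action `a · x` -/
  lact : A → carrier → carrier
  /-- the right action `x · a` -/
  ract : carrier → A → carrier
  /-- the left inner product, linear in the first variable -/
  linner : carrier → carrier → A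
  /-- the right inner product, linear in the second variable -/
  rinner : carrier → carrier → A
  /-- the involution `x ↦ x♯` -/
  sharp : carrier → carrier

attribute [instance] BimoduleData.addCommGroup BimoduleData.module

variable {A : Type u} [CStarAlgebra A]

/-- A sesquilinear form `p` is complete if the sequences that are Cauchy for the norm
`‖p x x‖ ^ (1 / 2)` converge for it. -/
def IsCompleteForm {X : Type u} [AddCommGroup X] (p : X → X → A) : Prop :=
  ∀ s : ℕ → X,
    (∀ ε : ℝ, 0 < ε → ∃ N, ∀ m ≥ N, ∀ n ≥ N, ‖p (s m - s n) (s m - s n)‖ < ε) →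
    ∃ x : X, ∀ ε : ℝ, 0 < ε → ∃ N, ∀ n ≥ N, ‖p (s n - x) (s n - x)‖ < ε

/-- `X` is an `A`-`A`-equivalence bimodule: a full left and a full right Hilbert `A`-module with
`⟪x, y⟫ z = x ⟨y, z⟩` for the left inner product `⟪ , ⟫` and the right inner product `⟨ , ⟩`. -/
structure BimoduleData.IsEquivalenceBimodule (X : BimoduleData A) : Prop where
  one_lact : ∀ x, X.lact 1 x = x
  mul_lact : ∀ a b x, X.lact (a * b) x = X.lact a (X.lact b x)
  add_lact : ∀ a b x, X.lact (a + b) x = X.lact a x + X.lact b x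
  lact_add : ∀ a x y, X.lact a (x + y) = X.lact a x + X.lact a y
  smul_lact : ∀ (c : ℂ) a x, X.lact (c • a) x = c • X.lact a x
  ract_one : ∀ x, X.ract x 1 = x
  ract_mul : ∀ x a b, X.ract x (a * b) = X.ract (X.ract x a) b
  ract_add : ∀ x a b, X.ract x (a + b) = X.ract x a + X.ract x b
  add_ract : ∀ x y a, X.ract (x + y) a = X.ract x a + X.ract y a
  ract_smul : ∀ x (c : ℂ) a, X.ract x (c • a) = c • X.ract x a
  lact_ract : ∀ a x b, X.ract (X.lact a x) b = X.lact a (X.ract x b)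
  linner_add : ∀ x y z, X.linner (x + y) z = X.linner x z + X.linner y z
  linner_lact : ∀ a x y, X.linner (X.lact a x) y = a * X.linner x y
  star_linner : ∀ x y, star (X.linner x y) = X.linner y x
  linner_self : ∀ x, ∃ a, X.linner x x = star a * a
  eq_zero_of_linner : ∀ x, X.linner x x = 0 → x = 0
  linner_complete : IsCompleteForm X.linner
  linner_full : Dense (Submodule.span ℂ {a | ∃ x y, X.linner x y = a} : Set A)
  linner_ract : ∀ x y a, X.linner (X.ract x a) y = X.linner x (X.ract y (star a))
  rinner_add : ∀ x y z, X.rinner x (y + z) = X.rinner x y + X.rinner x z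
  rinner_ract : ∀ x y a, X.rinner x (X.ract y a) = X.rinner x y * a
  star_rinner : ∀ x y, star (X.rinner x y) = X.rinner y x
  rinner_self : ∀ x, ∃ a, X.rinner x x = star a * a
  eq_zero_of_rinner : ∀ x, X.rinner x x = 0 → x = 0
  rinner_complete : IsCompleteForm X.rinner
  rinner_full : Dense (Submodule.span ℂ {a | ∃ x y, X.rinner x y = a} : Set A)
  rinner_lact : ∀ a x y, X.rinner (X.lact a x) y = X.rinner x (X.lact (star a) y)
  linner_lact_eq : ∀ x y z, X.lact (X.linner x y) z = X.ract x (X.rinner y z)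

/-- `X` is an involutive `A`-`A`-equivalence bimodule. -/
structure BimoduleData.IsInvolutive (X : BimoduleData A) : Prop
    extends X.IsEquivalenceBimodule where
  sharp_add : ∀ x y, X.sharp (x + y) = X.sharp x + X.sharp y
  sharp_smul : ∀ (c : ℂ) x, X.sharp (c • x) = star c • X.sharp x
  sharp_sharp : ∀ x, X.sharp (X.sharp x) = x
  sharp_act : ∀ a x b,
    X.sharp (X.ract (X.lact a x) b) = X.ract (X.lact (star b) (X.sharp x)) (star a)
  linner_sharp : ∀ x y, X.linner x (X.sharp y) = X.rinner (X.sharp x) y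

/-- `X ∼ Y`: there is an isomorphism of `A`-`A`-equivalence bimodules of `X` onto `Y` that
intertwines the involutions. -/
def BimoduleData.Isomorphic (X Y : BimoduleData A) : Prop :=
  ∃ ρ : X.carrier ≃ₗ[ℂ] Y.carrier,
    (∀ a x, ρ (X.lact a x) = Y.lact a (ρ x)) ∧
    (∀ x a, ρ (X.ract x a) = Y.ract (ρ x) a) ∧
    (∀ x y, Y.linner (ρ x) (ρ y) = X.linner x y) ∧
    (∀ x y, Y.rinner (ρ x) (ρ y) = X.rinner x y) ∧
    (∀ x, ρ (X.sharp x) = Y.sharp (ρ x))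

end Bimodules

section BimoduleOfInclusion

variable {B : Type u} [CStarAlgebra B] {A : StarSubalgebra ℂ B} [IsClosed (A : Set B)]
  (E : CondExp A)

/-- The isomorphism `ψ(a) = a e_A` of `A` onto `A e_A = e_A C⋆⟨B, e_A⟩ e_A`. -/
def CondExp.psi (a : A) : E.Adjointable := E.leftMul a * E.jones

/-- The isomorphism `φ(a) = a (1 - e_A)` of `A` onto `A (1 - e_A)`; it is the composite of `ψ` and
the dual automorphism. -/
def CondExp.phi (a : A) : E.Adjointable := E.leftMul a * (1 - E.jones)

/-- The corner `e_A C⋆⟨B, e_A⟩ (1 - e_A)`. -/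
def CondExp.corner : Submodule ℂ E.Adjointable where
  carrier := {T | T ∈ E.basicConstruction ∧ E.jones * T * (1 - E.jones) = T}
  zero_mem' := ⟨Submodule.zero_mem _, by simp⟩
  add_mem' := fun hS hT => ⟨Submodule.add_mem _ hS.1 hT.1, by
    rw [mul_add, add_mul, hS.2, hT.2]⟩
  smul_mem' := fun c T hT => ⟨Submodule.smul_mem _ c hT.1, by
    rw [mul_smul_comm, smul_mul_assoc, hT.2]⟩

theorem CondExp.leftMul_mul_mem_corner (a : A) {T : E.Adjointable} (hT : T ∈ E.corner) :
    E.leftMul a * T ∈ E.corner :=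
  ⟨E.leftMul_mul_mem _ hT.1, by
    rw [← mul_assoc, ← E.commute_jones, mul_assoc (E.leftMul a), mul_assoc (E.leftMul a), hT.2]⟩

theorem CondExp.mul_leftMul_mem_corner (a : A) {T : E.Adjointable} (hT : T ∈ E.corner) :
    T * E.leftMul a ∈ E.corner :=
  ⟨E.mul_leftMul_mem _ hT.1, by
    have h : E.leftMul a * (1 - E.jones) = (1 - E.jones) * E.leftMul a := by
      rw [mul_sub, sub_mul, mul_one, one_mul, E.commute_jones]
    rw [← mul_assoc, mul_assoc, h, ← mul_assoc, hT.2]⟩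

theorem CondExp.cut_dualAut_mem_corner (T : E.Adjointable) :
    E.jones * E.dualAut T * (1 - E.jones) ∈ E.corner := by
  have hidem : (1 - E.jones) * (1 - E.jones) = 1 - E.jones := by
    rw [sub_mul, one_mul, mul_sub, mul_one, E.jones_mul_jones, sub_self, sub_zero]
  refine ⟨?_, by
    rw [← mul_assoc, ← mul_assoc, E.jones_mul_jones, mul_assoc _ (1 - E.jones), hidem]⟩
  have hb : ∀ b : B, E.jones * E.leftMul b * (1 - E.jones) ∈ E.basicConstruction := fun b => by
    have h1 : E.jones * E.leftMul b ∈ E.basicSpan :=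
      Submodule.subset_span ⟨1, b, by rw [E.leftMul_one, one_mul]⟩
    have h2 : E.jones * E.leftMul b * E.jones ∈ E.basicSpan := by
      have : E.jones * E.leftMul b * E.jones = E.leftMul (E b : B) * E.jones * E.leftMul 1 := by
        rw [E.leftMul_one, mul_one]
        ext x
        · exact congrArg Subtype.val (E.map_mul_coe b (E x))
        · change ((E (star b * (E x : B)) : A) : B) = (E (star (E b : B) * x) : B)
          refine (congrArg Subtype.val (E.map_mul_coe (star b) (E x))).trans ?_
          change ((E (star b) * E x : A) : B) = _
          rw [E.map_star]
          exact (congrArg Subtype.val (E.map_coe_mul (star (E b)) x)).symm.trans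
            (by simp)
      rw [this]
      exact Submodule.subset_span ⟨_, 1, rfl⟩
    rw [mul_sub, mul_one]
    exact E.basicSpan_le (Submodule.sub_mem _ h1 h2)
  have hU : E.symmetry * (1 - E.jones) = -(1 - E.jones) := by
    rw [CondExp.symmetry, sub_mul, one_mul, mul_sub, mul_one, mul_assoc, E.jones_mul_jones]
    simp
  unfold CondExp.dualAut
  split_ifs with h
  · have e : E.jones * (E.leftMul h.choose.1 - E.leftMul h.choose.2 * E.symmetry)
          * (1 - E.jones)
        = E.jones * E.leftMul h.choose.1 * (1 - E.jones)
          + E.jones * E.leftMul h.choose.2 * (1 - E.jones) := by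
      rw [mul_sub E.jones, sub_mul _ _ (1 - E.jones), ← mul_assoc E.jones _ E.symmetry,
        mul_assoc _ E.symmetry, hU, mul_neg,
        sub_neg_eq_add]
    rw [e]
    exact Submodule.add_mem _ (hb _) (hb _)
  · simp

/-- The bimodule `X_B = e_A C⋆⟨B, e_A⟩ (1 - e_A)` with
`a · x · b = a x b`, `⟪x, y⟫ = ψ⁻¹(x y⋆)`, `⟨x, y⟩ = φ⁻¹(x⋆ y)` and `x♯ = β(x⋆)`, where `β` is the
dual automorphism. (Since `β` exchanges `e_A` and `1 - e_A`, cutting `β(x⋆)` down by them does not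
change it.) -/
def CondExp.bimodule : BimoduleData A where
  carrier := E.corner
  lact a x := ⟨E.leftMul a * x.1, E.leftMul_mul_mem_corner a x.2⟩
  ract x a := ⟨x.1 * E.leftMul a, E.mul_leftMul_mem_corner a x.2⟩
  linner x y := Function.invFun E.psi (x.1 * star y.1)
  rinner x y := Function.invFun E.phi (star x.1 * y.1)
  sharp x := ⟨E.jones * E.dualAut (star x.1) * (1 - E.jones), E.cut_dualAut_mem_corner _⟩

end BimoduleOfInclusion

/-! ## `2ℤ`-inner C⋆-dynamical systems -/

section InnerSystems

/-- A `2ℤ`-inner C⋆-dynamical system `(A, ℤ, α)`: the automorphism `α` of `A` that generates the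
action of `ℤ`, with a unitary `z` of `A` such that `α(z) = z` and `α² = Ad(z)`. -/
structure InnerSystem (A : Type u) [CStarAlgebra A] where
  α : A ≃⋆ₐ[ℂ] A
  z : unitary A
  map_z : α z = z
  map_map : ∀ a, α (α a) = z * a * star (z : A)

namespace InnerSystem

variable {A : Type u} [CStarAlgebra A] (S : InnerSystem A)

/-- The bimodule `X_α`: the vector space `A` with `a · x = a x`, `x · a = x α(a)`,
`⟪x, y⟫ = x y⋆`, `⟨x, y⟩ = α⁻¹(x⋆ y)` and `x♯ = (α(x) z)⋆ = z⋆ α(x⋆)`. -/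
def bimodule : BimoduleData A where
  carrier := A
  lact a x := a * x
  ract x a := x * S.α a
  linner x y := x * star y
  rinner x y := S.α.symm (star x * y)
  sharp x := star (S.z : A) * S.α (star x)

/-- The space `K(ℤ, A, z)` of all functions `f : ℤ → A` with `f(n - 2m) = f(n) z ^ m`. -/
def functions : Submodule ℂ (ℤ → A) where
  carrier := {f | ∀ n m : ℤ, f (n - 2 * m) = f n * ((S.z ^ m : unitary A) : A)}
  zero_mem' := fun n m => by simp
  add_mem' := fun {f g} hf hg n m => by simp [hf n m, hg n m, add_mul]
  smul_mem' := fun c f hf n m => by simp [hf n m]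

/-- The ⋆-algebra `K(ℤ, A, z)` with the twisted convolution
`(f g)(n) = ∑ f(k) α ^ k (g(n - k))`, the sum being over `k = 0, 1`, representatives of `ℤ / 2ℤ`,
and with `f⋆(n) = α ^ n (f(-n)⋆)`. -/
def Conv : Type u := S.functions

namespace Conv

variable {S}

instance : AddCommGroup S.Conv := inferInstanceAs (AddCommGroup S.functions)
instance : Module ℂ S.Conv := inferInstanceAs (Module ℂ S.functions)

instance : CoeFun S.Conv (fun _ => ℤ → A) := ⟨fun f => f.1⟩

theorem map_zpow_z (m : ℤ) : S.α ((S.z ^ m : unitary A) : A) = ((S.z ^ m : unitary A) : A) := by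
  let F : A →⋆* A := ⟨⟨⟨S.α, map_one S.α⟩, map_mul S.α⟩, map_star S.α⟩
  have h : Unitary.map F S.z = S.z := Subtype.ext S.map_z
  have h2 := map_zpow (Unitary.map F) S.z m
  rw [h] at h2
  exact congrArg Subtype.val h2

theorem zpow_map_zpow_z (n m : ℤ) :
    (S.α ^ n) ((S.z ^ m : unitary A) : A) = ((S.z ^ m : unitary A) : A) := by
  induction n using Int.induction_on with
  | zero => rw [zpow_zero, StarAlgEquiv.one_apply]
  | succ n ih => rw [zpow_add_one, StarAlgEquiv.mul_apply, map_zpow_z, ih]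
  | pred n ih =>
    rw [zpow_sub_one, StarAlgEquiv.mul_apply]
    nth_rewrite 1 [← map_zpow_z m]
    rw [StarAlgEquiv.aut_inv, StarAlgEquiv.symm_apply_apply, ih]

theorem zpow_two_mul_apply (m : ℤ) (a : A) :
    (S.α ^ (2 * m)) a
      = ((S.z ^ m : unitary A) : A) * a * star ((S.z ^ m : unitary A) : A) := by
  have h : S.α ^ (2 : ℤ) = Unitary.conjStarAlgAut ℂ A S.z := by
    ext x
    rw [zpow_two, StarAlgEquiv.mul_apply, S.map_map, Unitary.conjStarAlgAut_apply]
  rw [zpow_mul, h, ← map_zpow, Unitary.conjStarAlgAut_apply]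

theorem shift (f : S.Conv) (n m : ℤ) : f (n - 2 * m) = f n * ((S.z ^ m : unitary A) : A) :=
  f.2 n m

theorem shift_one (f : S.Conv) (n : ℤ) : f (n - 2) = f n * (S.z : A) := by
  simpa using f.shift n 1

theorem ext_all {f g : S.Conv} (h : ∀ n : ℤ, f n = g n) : f = g := Subtype.ext (funext h)

theorem ext_two {f g : S.Conv} (h0 : f 0 = g 0) (h1 : f 1 = g 1) : f = g := by
  refine ext_all fun n => ?_
  rcases Int.even_or_odd' n with ⟨k, rfl | rfl⟩
  · have hf := f.shift 0 (-k)
    have hg := g.shift 0 (-k)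
    rw [show (0 : ℤ) - 2 * -k = 2 * k by ring] at hf hg
    rw [hf, hg, h0]
  · have hf := f.shift 1 (-k)
    have hg := g.shift 1 (-k)
    rw [show (1 : ℤ) - 2 * -k = 2 * k + 1 by ring] at hf hg
    rw [hf, hg, h1]

@[simp] theorem add_apply (f g : S.Conv) (n : ℤ) : (f + g) n = f n + g n := rfl
@[simp] theorem zero_apply (n : ℤ) : (0 : S.Conv) n = 0 := rfl
@[simp] theorem smul_apply (c : ℂ) (f : S.Conv) (n : ℤ) : (c • f) n = c • f n := rfl

instance : Mul S.Conv :=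
  ⟨fun f g => ⟨fun n => f 0 * g n + f 1 * S.α (g (n - 1)), fun n m => by
    change f 0 * g (n - 2 * m) + f 1 * S.α (g (n - 2 * m - 1)) = _
    rw [sub_right_comm, g.shift, g.shift, map_mul, map_zpow_z, add_mul, mul_assoc, mul_assoc]⟩⟩

theorem mul_apply (f g : S.Conv) (n : ℤ) : (f * g) n = f 0 * g n + f 1 * S.α (g (n - 1)) := rfl

/-- The function supported on `2ℤ` whose value at `0` is `a`. -/
def single (a : A) : S.Conv :=
  ⟨fun n => if Even n then a * ((S.z ^ (-(n / 2)) : unitary A) : A) else 0, fun n m => by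
    have h : Even (n - 2 * m) ↔ Even n := by simp [Int.even_sub]
    by_cases hn : Even n
    · simp only [h, hn, if_true]
      rw [mul_assoc, ← Submonoid.coe_mul, ← zpow_add, show (n - 2 * m) / 2 = n / 2 - m by omega,
        neg_sub, sub_eq_neg_add]
    · simp [h, hn]⟩

@[simp] theorem single_zero (a : A) : (single a : S.Conv) 0 = a := by simp [single]
@[simp] theorem single_one (a : A) : (single a : S.Conv) 1 = 0 := by simp [single]

instance : One S.Conv := ⟨single 1⟩

@[simp] theorem one_zero : (1 : S.Conv) 0 = 1 := single_zero 1
@[simp] theorem one_one : (1 : S.Conv) 1 = 0 := single_one 1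

theorem shift_neg_one (f : S.Conv) : f (-1) = f 1 * (S.z : A) := f.shift_one 1

instance : Ring S.Conv :=
  { (inferInstance : AddCommGroup S.Conv) with
    mul := (· * ·)
    one := 1
    left_distrib := fun f g h => ext_all fun n => by
      simp only [mul_apply, add_apply, map_add, mul_add]; abel
    right_distrib := fun f g h => ext_all fun n => by
      simp only [mul_apply, add_apply, add_mul]; abel
    zero_mul := fun f => ext_all fun n => by simp [mul_apply]
    mul_zero := fun f => ext_all fun n => by simp [mul_apply]
    one_mul := fun f => ext_all fun n => by simp [mul_apply]
    mul_one := fun f => ext_two (by simp [mul_apply, shift_neg_one])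
      (by simp [mul_apply])
    mul_assoc := fun f g h => ext_all fun n => by
      have e : h (n - 1 - 1) = h n * (S.z : A) := by
        rw [sub_sub]; exact h.shift_one n
      have u : star (S.z : A) * (S.z : A) = 1 := Unitary.coe_star_mul_self S.z
      simp only [mul_apply, e, map_add, map_mul, S.map_z, S.map_map, mul_add, add_mul,
        zero_sub, shift_neg_one, mul_assoc, u, mul_one]
      abel }

instance : Algebra ℂ S.Conv :=
  Algebra.ofModule (fun c f g => ext_all fun n => by simp [mul_apply])
    (fun c f g => ext_all fun n => by simp [mul_apply])

instance : Star S.Conv :=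
  ⟨fun f => ⟨fun n => (S.α ^ n) (star (f (-n))), fun n m => by
    have hz : star ((S.z ^ (-m) : unitary A) : A) = ((S.z ^ m : unitary A) : A) := by
      rw [zpow_neg, ← Unitary.star_eq_inv, Unitary.coe_star, star_star]
    have hz' : ((S.z ^ (-m) : unitary A) : A) * ((S.z ^ m : unitary A) : A) = 1 := by
      rw [← Submonoid.coe_mul, ← zpow_add, neg_add_cancel, zpow_zero, Submonoid.coe_one]
    change (S.α ^ (n - 2 * m)) (star (f (-(n - 2 * m)))) = (S.α ^ n) (star (f (-n))) * _
    rw [show -(n - 2 * m) = -n - 2 * (-m) by ring, f.shift, star_mul, hz,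
      show n - 2 * m = n + 2 * (-m) by ring, zpow_add, StarAlgEquiv.mul_apply,
      zpow_two_mul_apply, hz, ← mul_assoc, hz', one_mul, map_mul, zpow_map_zpow_z]⟩⟩

theorem star_apply (f : S.Conv) (n : ℤ) : (star f) n = (S.α ^ n) (star (f (-n))) := rfl

instance : StarRing S.Conv where
  star_involutive f := ext_all fun n => by
    rw [star_apply, star_apply, neg_neg, ← map_star, star_star, ← StarAlgEquiv.mul_apply,
      ← zpow_add]
    simp
  star_mul f g := ext_two
    (by
      have e : S.α ((S.α ^ (0 - 1 : ℤ)) (star (f (-(0 - 1))))) = star (f 1) := by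
        rw [← StarAlgEquiv.mul_apply, ← zpow_one_add]
        simp
      rw [star_apply, mul_apply, mul_apply, star_apply, star_apply, star_apply, star_apply, e]
      simp [map_star])
    (by
      have e : S.α (star (g (-1 - 1))) = star (S.z : A) * S.α (star (g 0)) := by
        rw [show (-1 - 1 : ℤ) = 0 - 2 by norm_num, g.shift_one, star_mul, map_mul, map_star S.α
          (S.z : A), S.map_z]
      have e' : S.α (S.α (star (g (-1 - 1)))) = star (g 0) * star (S.z : A) := by
        rw [e, map_mul, map_star S.α (S.z : A), S.map_z, S.map_map, mul_assoc (S.z : A),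
          ← mul_assoc, Unitary.coe_star_mul_self, one_mul]
      rw [star_apply, mul_apply, mul_apply, star_apply, star_apply, star_apply, star_apply]
      simp only [zpow_one, neg_zero, zpow_zero, StarAlgEquiv.one_apply, sub_self, star_add,
        star_mul, map_add, map_mul, shift_neg_one f, ← map_star S.α (g (-1 - 1)), e',
        map_star S.α (S.z : A), S.map_z, mul_assoc]
      exact add_comm _ _)
  star_add f g := ext_all fun n => by simp [star_apply]

instance : StarModule ℂ S.Conv :=
  ⟨fun c f => ext_all fun n => by simp [star_apply]⟩


end Conv

/-- `D` is Green's restricted crossed product `A ⋊_{α/2ℤ} ℤ` through `ι : K(ℤ, A, z) → D`: the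
enveloping C⋆-algebra of `K(ℤ, A, z)`, that is, its completion for the largest C⋆-seminorm
`f ↦ sup ‖σ f‖`, where `σ` runs over the ⋆-homomorphisms into C⋆-algebras. -/
structure IsRestrictedCrossedProduct {D : Type u} [CStarAlgebra D] (ι : S.Conv →⋆ₐ[ℂ] D) :
    Prop where
  denseRange : DenseRange ι
  isLUB_norm : ∀ f : S.Conv,
    IsLUB {r : ℝ | ∃ (C : Type u) (_ : CStarAlgebra C) (σ : S.Conv →⋆ₐ[ℂ] C), r = ‖σ f‖} ‖ι f‖

end InnerSystem

end InnerSystems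

end

end IndexTwo

namespace IndexTwo

/-! ## Positivity in matrix algebras -/

section Positivity

/-! Write `K = ker E`, so that `B = A ⊕ K` as an `A`-bimodule. Index two forces `K K ⊆ A`
(`CondExp.HasIndex.kernel_mul_kernel`), that is, `B` is `ℤ/2`-graded with even part `A` and odd part
`K`. To see this, take a quasi-basis of the form `(z i, z i⋆)`, which exists because Gram matrices
`E(x i⋆ x j)` are positive over `A`. The odd parts `c i` of the `z i` satisfy `∑ c i c i⋆ = 2 - 1 -
1 + 1 = 1`. For odd `x` the odd parts of the `c i⋆ x` then have squares whose expectations sum to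
zero, and they vanish because `E` is faithful.

The corner `e_A C⋆⟨B, e_A⟩ (1 - e_A)` is `e_A K`, and `k ↦ e_A k` identifies `X_B` with `K` carrying
the inner products `x y⋆`, `x⋆ y` and the involution `x⋆`
(`CondExp.HasIndex.kernelBimodule_isomorphic`). Each of the three conditions then says that `K`
contains a unitary `u`. A partial isometry from `e_A` to `1 - e_A` is `(e_A u)⋆`; the quasi-basis
expands `b` as `E(b) + u E(u⋆ b)`; an isomorphism `X_α ≅ K` sends `1` to `u`, with `α = Ad(u)` and
`z = u²`. In the last case `K = A u`, hence `B = A ⊕ A u`, and `f ↦ f(0) + f(1) u` identifies the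
restricted crossed product with `B`. -/

theorem eq_zero_of_sum_star_mul_self {D : Type u} [CStarAlgebra D] {ι : Type*} [Fintype ι]
    (d : ι → D) (h : ∑ i, star (d i) * d i = 0) (i : ι) : d i = 0 := by
  let _ : PartialOrder D := CStarAlgebra.spectralOrder D
  have _ : StarOrderedRing D := CStarAlgebra.spectralOrderedRing D
  have := (Finset.sum_eq_zero_iff_of_nonneg (fun i _ => star_mul_self_nonneg (d i))).mp h i
    (Finset.mem_univ i)
  exact CStarRing.star_mul_self_eq_zero_iff _ |>.mp this

/-- The negative part `K` of a self-adjoint element `M`, with a root `s` of it. -/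
theorem exists_negPart_root {R : Type u} [CStarAlgebra R] {M : R} (hsa : IsSelfAdjoint M) :
    ∃ K s : R, star K = K ∧ K = star s * s ∧ K * M * K + star (s * K) * (s * K) = 0 ∧
      (K = 0 → ∃ C, M = star C * C) := by
  let _ : PartialOrder R := CStarAlgebra.spectralOrder R
  have _ : StarOrderedRing R := CStarAlgebra.spectralOrderedRing R
  have hK : 0 ≤ M⁻ := CFC.negPart_nonneg M
  have hKsa : star M⁻ = M⁻ := (IsSelfAdjoint.of_nonneg hK)
  obtain ⟨s, hs⟩ := CStarAlgebra.nonneg_iff_eq_star_mul_self.mp hK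
  refine ⟨M⁻, s, hKsa, hs, ?_, fun h =>
    CStarAlgebra.nonneg_iff_eq_star_mul_self.mp ((CFC.negPart_eq_zero_iff M hsa).mp h)⟩
  have h3 : M⁻ * M = - (M⁻ * M⁻) := by
    calc M⁻ * M = M⁻ * (M⁺ - M⁻) := by rw [CFC.posPart_sub_negPart M hsa]
      _ = _ := by rw [mul_sub, CFC.negPart_mul_posPart, zero_sub]
  -- The cube of the negative part is written as a square, so that for a matrix its diagonal entries
  -- are visibly sums of squares.
  have h4 : star (s * M⁻) * (s * M⁻) = M⁻ * M⁻ * M⁻ := by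
    rw [star_mul, hKsa, mul_assoc, ← mul_assoc (star s), ← hs, mul_assoc]
  rw [h3, h4, neg_mul, neg_add_cancel]

/-- A hermitian matrix over a C⋆-algebra whose quadratic form takes values in the positive cone
is a Gram matrix. -/
theorem exists_gram_of_quadratic_form {D : Type u} [CStarAlgebra D] {n : ℕ}
    (H : Fin n → Fin n → D) (hH : ∀ i j, star (H i j) = H j i)
    (hpos : ∀ c : Fin n → D, ∃ d, ∑ i, ∑ j, star (c i) * H i j * c j = star d * d) :
    ∃ C : Fin n → Fin n → D, ∀ i j, H i j = ∑ k, star (C k i) * C k j := by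
  let _ : PartialOrder D := CStarAlgebra.spectralOrder D
  have _ : StarOrderedRing D := CStarAlgebra.spectralOrderedRing D
  set M : CStarMatrix (Fin n) (Fin n) D := CStarMatrix.ofMatrix (Matrix.of H) with hM
  have hsa : IsSelfAdjoint M := by
    ext i j
    exact hH j i
  obtain ⟨K, s, hKsa, hs, hcube, hroot⟩ := exists_negPart_root hsa
  -- The `i`-th diagonal entry of `K M K` is the quadratic form at the `i`-th column of `K`, hence
  -- positive, and that of `(s K)⋆ (s K)` is a sum of squares. They add up to zero, so both vanish.
  have hsK : s * K = 0 := by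
    ext k i
    obtain ⟨d, hd⟩ := hpos fun j => K j i
    have hdiag := congrArg (fun N : CStarMatrix (Fin n) (Fin n) D => N i i) hcube
    have e1 : (K * M * K) i i = star d * d := by
      rw [← hd, CStarMatrix.mul_apply]
      simp only [CStarMatrix.mul_apply, Finset.sum_mul]
      rw [Finset.sum_comm]
      refine Finset.sum_congr rfl fun a _ => Finset.sum_congr rfl fun b _ => ?_
      have : star (K a i) = K i a := congrArg (fun N : CStarMatrix (Fin n) (Fin n) D => N i a) hKsa
      rw [this]
      rfl
    have e2 : (star (s * K) * (s * K)) i i = ∑ k, star ((s * K) k i) * (s * K) k i := by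
      rw [CStarMatrix.mul_apply]
      rfl
    rw [CStarMatrix.add_apply, e1, e2, CStarMatrix.zero_apply] at hdiag
    have hnn : 0 ≤ ∑ k, star ((s * K) k i) * (s * K) k i :=
      Finset.sum_nonneg fun k _ => star_mul_self_nonneg _
    have hz : ∑ k, star ((s * K) k i) * (s * K) k i = 0 :=
      ((add_eq_zero_iff_of_nonneg (star_mul_self_nonneg d) hnn).mp hdiag).2
    exact eq_zero_of_sum_star_mul_self _ hz k
  have hK0 : K = 0 := by
    have : star K * K = 0 := by
      rw [hKsa]
      nth_rewrite 1 [hs]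
      rw [mul_assoc, hsK, mul_zero]
    exact (CStarRing.star_mul_self_eq_zero_iff K).mp this
  obtain ⟨C, hC⟩ := hroot hK0
  refine ⟨fun k i => C k i, fun i j => ?_⟩
  have := congrArg (fun N : CStarMatrix (Fin n) (Fin n) D => N i j) hC
  simp only [CStarMatrix.mul_apply] at this
  exact this

end Positivity

/-! ## Conditional expectations of index-finite type -/

section Expectation

variable {B : Type u} [CStarAlgebra B] {A : StarSubalgebra ℂ B} (E : CondExp A)

theorem CondExp.apply_coe (a : A) : E (a : B) = a := E.map_coe a

theorem CondExp.apply_coe_mul (a : A) (b : B) : E ((a : B) * b) = a * E b := E.map_coe_mul a b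

theorem CondExp.apply_mul_coe (b : B) (a : A) : E (b * (a : B)) = E b * a := E.map_mul_coe b a

theorem CondExp.apply_star_mul_self (b : B) : ∃ c : A, E (star b * b) = star c * c :=
  E.map_star_mul_self b

theorem CondExp.coe_map_star (b : B) : (E (star b) : B) = star (E b : B) :=
  congrArg Subtype.val (E.map_star b)

theorem CondExp.apply_one : E 1 = 1 := E.apply_coe 1

/-- This follows from `E(b)⋆ E(b) ≤ E(b⋆ b) ≤ ‖b‖²`; the first difference is the expectation of the
square of `b - E(b)`. -/
theorem CondExp.norm_apply_le [IsClosed (A : Set B)] (b : B) : ‖E b‖ ≤ ‖b‖ := by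
  have h1 : ‖E (star b * b)‖ ≤ ‖b‖ ^ 2 := by
    have h := E.normSq_mul_le b 1
    simp only [CondExp.normSq, mul_one, star_one, E.apply_one] at h
    refine h.trans (mul_le_of_le_one_right (sq_nonneg _) ?_)
    -- In the zero algebra `‖1‖ = 0`, so only `‖1‖ ≤ 1` is available in general.
    rcases subsingleton_or_nontrivial A with _ | _
    · rw [Subsingleton.elim (1 : A) 0, norm_zero]; exact zero_le_one
    · rw [norm_one]
  have h2 := norm_le_of_star_mul_self (D := A) ⟨E b, rfl⟩
    (E.apply_star_mul_self (b - (E b : B)))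
  have e : star (E b) * E b + E (star (b - (E b : B)) * (b - (E b : B))) = E (star b * b) := by
    have e' : star (b - (E b : B)) * (b - (E b : B))
        = star b * b - star b * (E b : B) - ((star (E b) : A) : B) * b
          + (((star (E b) * E b : A)) : B) := by
      push_cast
      rw [star_sub, StarMemClass.coe_star]
      noncomm_ring
    rw [e', map_add, map_sub, map_sub, E.apply_mul_coe, E.apply_coe_mul, E.apply_coe, E.map_star]
    abel
  rw [e] at h2
  rw [CStarRing.norm_star_mul_self, ← sq] at h2
  exact (sq_le_sq₀ (norm_nonneg _) (norm_nonneg _)).mp (h2.trans h1)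

/-- The variational proof of the Cauchy–Schwarz inequality: with `h = E(x⋆ b)`, positivity of `E(y⋆
y)` for `y = b - ε x h` bounds `2 ε h⋆ h` by a term of order `ε²`, and `ε` tends to `0`. -/
theorem CondExp.inner_eq_zero [IsClosed (A : Set B)] {b : B} (hb : E (star b * b) = 0) (x : B) :
    E (star x * b) = 0 := by
  set h := E (star x * b) with hh
  have hs : E (star b * x) = star h := by
    rw [hh, ← E.map_star, star_mul, star_star]
  have key : ∀ ε : ℝ, 0 < ε → 2 * ‖h‖ ^ 2 ≤ ε * ‖star h * E (star x * x) * h‖ := fun ε hε => by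
    set y := b - x * (((ε : ℂ) • h : A) : B) with hy
    have e : E (star y * y) + ((2 * ε : ℝ) : ℂ) • (star h * h)
        = ((ε ^ 2 : ℝ) : ℂ) • (star h * E (star x * x) * h) := by
      have e' : star y * y = star b * b - (star b * x) * (((ε : ℂ) • h : A) : B)
          - ((star ((ε : ℂ) • h) : A) : B) * (star x * b)
          + ((star ((ε : ℂ) • h) : A) : B) * ((star x * x) * (((ε : ℂ) • h : A) : B)) := by
        rw [hy, star_sub, star_mul, StarMemClass.coe_star]
        noncomm_ring
      rw [e', map_add, map_sub, map_sub, E.apply_mul_coe, E.apply_coe_mul, E.apply_coe_mul,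
        E.apply_mul_coe, hb, hs, ← hh]
      simp only [star_smul, smul_mul_assoc, mul_smul_comm, Complex.star_def, Complex.conj_ofReal,
        smul_smul, mul_assoc]
      push_cast
      module
    have hsq : ∃ c : A, ((2 * ε : ℝ) : ℂ) • (star h * h) = star c * c := by
      refine ⟨((Real.sqrt (2 * ε) : ℝ) : ℂ) • h, ?_⟩
      rw [star_smul, smul_mul_smul_comm, Complex.star_def, Complex.conj_ofReal,
        ← Complex.ofReal_mul, Real.mul_self_sqrt (by positivity)]
    have hn := norm_le_of_star_mul_self (D := A) hsq (E.apply_star_mul_self y)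
    rw [add_comm, e, norm_smul, norm_smul, CStarRing.norm_star_mul_self, Complex.norm_real,
      Complex.norm_real, Real.norm_of_nonneg (by positivity), Real.norm_of_nonneg (by positivity)]
      at hn
    have : ε * (2 * ‖h‖ ^ 2) ≤ ε * (ε * ‖star h * E (star x * x) * h‖) := by
      nlinarith
    exact le_of_mul_le_mul_left this hε
  have hle : 2 * ‖h‖ ^ 2 ≤ 0 := by
    refine le_of_forall_pos_le_add fun δ hδ => ?_
    set N := ‖star h * E (star x * x) * h‖
    have hN : 0 ≤ N := norm_nonneg _
    -- The denominator `N + 1` in place of `N` covers the case `N = 0`.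
    refine (key (δ / (N + 1)) (by positivity)).trans ?_
    rw [zero_add, div_mul_eq_mul_div, div_le_iff₀ (by positivity)]
    nlinarith
  have : ‖h‖ = 0 := by nlinarith [norm_nonneg h]
  exact norm_eq_zero.mp this

/-- The coefficients `E(y i b)` of `b` in the quasi-basis are inner products with a degenerate
vector, so all of them vanish. -/
theorem CondExp.IsQuasiBasis.faithful [IsClosed (A : Set B)] {E : CondExp A} {ι : Type}
    [Fintype ι] {x y : ι → B} (hxy : E.IsQuasiBasis x y) {b : B} (hb : E (star b * b) = 0) :
    b = 0 := by
  rw [← (hxy b).1]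
  refine Finset.sum_eq_zero fun i _ => ?_
  have := E.inner_eq_zero hb (star (y i))
  rw [star_star] at this
  rw [this, ZeroMemClass.coe_zero, mul_zero]

theorem CondExp.HasIndex.faithful [IsClosed (A : Set B)] {E : CondExp A} {c : B}
    (hE : E.HasIndex c) {b : B} (hb : E (star b * b) = 0) : b = 0 := by
  obtain ⟨n, x, y, h, -⟩ := hE
  exact h.faithful hb

/-- The quadratic form of this matrix at `c` is `E(w⋆ w)` with `w = ∑ x i c i`, so positivity of `E`
on `B` itself suffices. -/
theorem CondExp.exists_gram [IsClosed (A : Set B)] {n : ℕ} (x : Fin n → B) :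
    ∃ C : Fin n → Fin n → A, ∀ i j, E (star (x i) * x j) = ∑ k, star (C k i) * C k j := by
  refine exists_gram_of_quadratic_form (D := A) (fun i j => E (star (x i) * x j)) (fun i j => ?_)
    fun c => ?_
  · rw [← E.map_star, star_mul, star_star]
  · obtain ⟨d, hd⟩ := E.apply_star_mul_self (∑ i, x i * (c i : B))
    refine ⟨d, ?_⟩
    rw [← hd, star_sum, Finset.sum_mul, map_sum]
    refine Finset.sum_congr rfl fun i _ => ?_
    rw [Finset.mul_sum, map_sum]
    refine Finset.sum_congr rfl fun j _ => ?_
    rw [star_mul, ← StarMemClass.coe_star, mul_assoc ((star (c i) : A) : B), E.apply_coe_mul,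
      ← mul_assoc (star (x i)), E.apply_mul_coe, mul_assoc]

/-- A quasi-basis can be chosen of the form `(z i, star (z i))`. -/
theorem CondExp.HasIndex.exists_star [IsClosed (A : Set B)] {E : CondExp A} {c : B}
    (hE : E.HasIndex c) :
    ∃ (n : ℕ) (z : Fin n → B), (∀ b, ∑ i, z i * (E (star (z i) * b) : B) = b) ∧
      (∀ b, ∑ i, (E (b * z i) : B) * star (z i) = b) ∧ ∑ i, z i * star (z i) = c := by
  have hE' := hE
  obtain ⟨n, x, y, h, -⟩ := hE
  obtain ⟨C, hC⟩ := E.exists_gram x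
  -- The adjoint pairs `(y i⋆, x i⋆)` also form a quasi-basis. Combining the two expansions gives `b
  -- = ∑ y i⋆ E(x i⋆ x j) E(y j b)`, and the factorization `C⋆ C` of the middle matrix is split
  -- evenly between the two sides.
  set z : Fin n → B := fun k => ∑ j, star (y j) * ((star (C k j) : A) : B) with hz
  have hz1 : ∀ b, ∑ k, z k * (E (star (z k) * b) : B) = b := fun b => by
    have e1 : ∀ k, E (star (z k) * b) = ∑ j, C k j * E (y j * b) := fun k => by
      rw [hz, star_sum, Finset.sum_mul, map_sum]
      refine Finset.sum_congr rfl fun j _ => ?_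
      rw [star_mul, star_star, StarMemClass.coe_star, star_star, mul_assoc, E.apply_coe_mul]
    calc ∑ k, z k * (E (star (z k) * b) : B)
        = ∑ k, ∑ i, ∑ j, star (y i) * ((star (C k i) * C k j * E (y j * b) : A) : B) := by
          refine Finset.sum_congr rfl fun k _ => ?_
          rw [e1, hz, Finset.sum_mul]
          refine Finset.sum_congr rfl fun i _ => ?_
          rw [AddSubmonoidClass.coe_finsetSum, Finset.mul_sum]
          refine Finset.sum_congr rfl fun j _ => ?_
          push_cast
          noncomm_ring
      _ = ∑ i, star (y i) * (∑ j, E (star (x i) * x j) * E (y j * b) : A) := by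
          rw [Finset.sum_comm]
          refine Finset.sum_congr rfl fun i _ => ?_
          rw [Finset.sum_comm, AddSubmonoidClass.coe_finsetSum, Finset.mul_sum]
          refine Finset.sum_congr rfl fun j _ => ?_
          rw [← Finset.mul_sum, ← AddSubmonoidClass.coe_finsetSum, ← Finset.sum_mul, ← hC]
      _ = ∑ i, star (y i) * (E (star (x i) * b) : B) := by
          refine Finset.sum_congr rfl fun i _ => ?_
          congr 2
          conv_rhs => rw [← (h b).1, Finset.mul_sum, map_sum]
          refine Finset.sum_congr rfl fun j _ => ?_
          rw [← mul_assoc, E.apply_mul_coe]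
      _ = star (∑ i, (E (star b * x i) : B) * y i) := by
          rw [star_sum]
          refine Finset.sum_congr rfl fun i _ => ?_
          rw [star_mul, ← E.coe_map_star, star_mul, star_star]
      _ = b := by rw [(h (star b)).2, star_star]
  have hz2 : ∀ b, ∑ k, (E (b * z k) : B) * star (z k) = b := fun b => by
    have := congrArg star (hz1 (star b))
    rw [star_sum, star_star] at this
    refine Eq.trans (Finset.sum_congr rfl fun k _ => ?_) this
    rw [star_mul, ← E.coe_map_star, star_mul, star_star, star_star]
  refine ⟨n, z, hz1, hz2, ?_⟩
  exact CondExp.HasIndex.unique ⟨n, z, fun k => star (z k), fun b => ⟨hz1 b, hz2 b⟩, rfl⟩ hE'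

end Expectation

/-! ## The kernel of a conditional expectation of index two -/

section Kernel

variable {B : Type u} [CStarAlgebra B] {A : StarSubalgebra ℂ B} (E : CondExp A)

/-- The kernel of `E`. -/
noncomputable def CondExp.kernel : Submodule ℂ B := LinearMap.ker E.toLinearMap

theorem CondExp.mem_kernel {x : B} : x ∈ E.kernel ↔ E x = 0 := Iff.rfl

theorem CondExp.star_mem_kernel {x : B} (hx : x ∈ E.kernel) : star x ∈ E.kernel := by
  rw [E.mem_kernel] at hx ⊢
  rw [E.map_star, hx, star_zero]

theorem CondExp.coe_mul_mem_kernel (a : A) {x : B} (hx : x ∈ E.kernel) :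
    (a : B) * x ∈ E.kernel := by
  rw [E.mem_kernel] at hx ⊢
  rw [E.apply_coe_mul, hx, mul_zero]

theorem CondExp.mul_coe_mem_kernel {x : B} (hx : x ∈ E.kernel) (a : A) :
    x * (a : B) ∈ E.kernel := by
  rw [E.mem_kernel] at hx ⊢
  rw [E.apply_mul_coe, hx, zero_mul]

theorem CondExp.sub_apply_mem_kernel (b : B) : b - (E b : B) ∈ E.kernel := by
  rw [E.mem_kernel, map_sub, E.apply_coe, sub_self]

theorem CondExp.isClosed_kernel [IsClosed (A : Set B)] : IsClosed (E.kernel : Set B) := by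
  have hc : Continuous E.toLinearMap :=
    AddMonoidHomClass.continuous_of_bound E.toLinearMap 1 fun b => by
      rw [one_mul]; exact E.norm_apply_le b
  exact isClosed_singleton.preimage hc

variable {E}

/-- For an expectation of index two, the kernel has a normalized frame, and the products of the
adjoints of its elements with elements of the kernel are in `A`. -/
theorem CondExp.HasIndex.exists_kernel_frame [IsClosed (A : Set B)] (hE : E.HasIndex 2) :
    ∃ (n : ℕ) (c : Fin n → B), (∀ k, c k ∈ E.kernel) ∧ ∑ k, c k * star (c k) = 1 ∧
      (∀ y ∈ E.kernel, ∑ k, (E (y * c k) : B) * star (c k) = y) ∧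
      ∀ k, ∀ x ∈ E.kernel, (E (star (c k) * x) : B) = star (c k) * x := by
  obtain ⟨n, z, hz1, hz2, hz⟩ := hE.exists_star
  set c : Fin n → B := fun k => z k - (E (z k) : B) with hc
  have hstar : ∀ k, star (c k) = star (z k) - (E (star (z k)) : B) := fun k => by
    rw [hc, star_sub, E.coe_map_star]
  have hcK : ∀ k, c k ∈ E.kernel := fun k => E.sub_apply_mem_kernel (z k)
  have hsum1 : ∑ k, z k * (E (star (z k)) : B) = 1 := by simpa using hz1 1
  have hsum2 : ∑ k, (E (z k) : B) * star (z k) = 1 := by simpa using hz2 1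
  have hsum3 : ∑ k, (E (z k) : B) * (E (star (z k)) : B) = 1 := by
    have := congrArg (fun b : B => (E b : B)) hsum1
    simp only [map_sum, E.apply_mul_coe, E.apply_one] at this
    push_cast at this
    exact this
  -- The four sums are `2`, `1`, `1` and `1`. This is where the value of the index enters.
  have hcc : ∑ k, c k * star (c k) = 1 := by
    have : ∀ k, c k * star (c k) = z k * star (z k) - z k * (E (star (z k)) : B)
        - (E (z k) : B) * star (z k) + (E (z k) : B) * (E (star (z k)) : B) := fun k => by
      rw [hstar, hc]; noncomm_ring
    simp only [this, Finset.sum_add_distrib, Finset.sum_sub_distrib, hz, hsum1, hsum2, hsum3]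
    norm_num
  have hEc : ∀ k, ∀ x ∈ E.kernel, E (star (c k) * x) = E (star (z k) * x) := fun k x hx => by
    rw [hstar, sub_mul, map_sub, E.apply_coe_mul, E.mem_kernel.mp hx, mul_zero, sub_zero]
  refine ⟨n, c, hcK, hcc, fun y hy => ?_, fun k x hx => ?_⟩
  · have e1 : ∀ k, E (y * c k) = E (y * z k) := fun k => by
      rw [hc, mul_sub, map_sub, E.apply_mul_coe, E.mem_kernel.mp hy, zero_mul, sub_zero]
    -- This is `E` applied to the expansion of `y`, an element of the kernel.
    have e2 : ∑ k, (E (y * z k) : B) * (E (star (z k)) : B) = 0 := by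
      have := congrArg (fun b : B => (E b : B)) (hz2 y)
      simp only [map_sum, E.apply_coe_mul, E.mem_kernel.mp hy] at this
      push_cast at this
      exact this
    simp only [e1, hstar, mul_sub, Finset.sum_sub_distrib, e2, hz2 y, sub_zero]
  -- `w k` is the component of `c k⋆ x` in the kernel, which has to vanish.
  · set w : Fin n → B := fun k => star (c k) * x - (E (star (c k) * x) : B) with hw
    have hterm : ∀ k, E (star (w k) * w k)
        = E (star x * (c k * star (c k)) * x) - E (star x * (z k * (E (star (z k) * x) : B))) :=
      fun k => by
        have e : star (w k) * w k = star x * (c k * star (c k)) * x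
            - star (star (c k) * x) * (E (star (c k) * x) : B)
            - ((star (E (star (c k) * x)) : A) : B) * (star (c k) * x)
            + ((star (E (star (c k) * x)) * E (star (c k) * x) : A) : B) := by
          rw [hw]; push_cast; simp only [star_sub, star_mul, star_star, StarMemClass.coe_star]
          noncomm_ring
        have e3 : E (star x * z k) = star (E (star (z k) * x)) := by
          rw [← E.map_star, star_mul, star_star]
        rw [e, map_add, map_sub, map_sub, E.apply_mul_coe, E.apply_coe_mul, E.apply_coe,
          ← mul_assoc (star x) (z k), E.apply_mul_coe, E.map_star, hEc k x hx, e3]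
        abel
    -- The first terms add up to `E(x⋆ x)` since `∑ c k c k⋆ = 1`, and so do the second ones, by the
    -- expansion of `x` in the `z k`.
    have hzero : ∑ k, E (star (w k) * w k) = 0 := by
      simp only [hterm, Finset.sum_sub_distrib]
      rw [← map_sum, ← map_sum, ← Finset.sum_mul, ← Finset.mul_sum, ← Finset.mul_sum, hcc, hz1,
        mul_one, sub_self]
    choose d hd using fun k => E.apply_star_mul_self (w k)
    simp only [hd] at hzero
    have hd0 : d k = 0 := eq_zero_of_sum_star_mul_self (D := A) d hzero k
    have hwk : w k = 0 := hE.faithful (by rw [hd, hd0, mul_zero])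
    exact (sub_eq_zero.mp hwk).symm

/-- Expanding `x = ∑ E(x c k) c k⋆` reduces the claim to the products `c k⋆ y`, which lie in `A`.
Thus `A ⊕ ker E` is a `ℤ/2`-grading of `B`; nearly everything below rests on this. -/
theorem CondExp.HasIndex.kernel_mul_kernel [IsClosed (A : Set B)] (hE : E.HasIndex 2) {x y : B}
    (hx : x ∈ E.kernel) (hy : y ∈ E.kernel) : (E (x * y) : B) = x * y := by
  obtain ⟨n, c, -, -, h2, h3⟩ := hE.exists_kernel_frame
  have e : x * y = ((∑ k, E (x * c k) * E (star (c k) * y) : A) : B) := by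
    conv_lhs => rw [← h2 x hx, Finset.sum_mul]
    rw [AddSubmonoidClass.coe_finsetSum]
    refine Finset.sum_congr rfl fun k _ => ?_
    rw [mul_assoc, ← h3 k y hy, E.apply_coe]
    rfl
  rw [e, E.apply_coe]

/-- The unit is `∑ c k c k⋆` with all `c k` in the kernel. Operators that are left multiplications
on the kernel therefore determine their multipliers. -/
theorem CondExp.HasIndex.eq_zero_of_mul_kernel [IsClosed (A : Set B)] (hE : E.HasIndex 2) {b : B}
    (h : ∀ x ∈ E.kernel, b * x = 0) : b = 0 := by
  obtain ⟨n, c, h0, h1, -, -⟩ := hE.exists_kernel_frame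
  rw [← mul_one b, ← h1, Finset.mul_sum]
  refine Finset.sum_eq_zero fun k _ => ?_
  rw [← mul_assoc, h _ (h0 k), zero_mul]

end Kernel

/-! ## Involutive equivalence bimodules -/

section Transfer

variable {A : Type u} [CStarAlgebra A]

theorem isCompleteForm_of_norm_sq {X : Type u} [NormedAddCommGroup X] [CompleteSpace X]
    {p : X → X → A} (hp : ∀ x, ‖p x x‖ = ‖x‖ ^ 2) : IsCompleteForm p := fun s hs => by
  have hc : CauchySeq s := Metric.cauchySeq_iff.mpr fun ε hε => by
    obtain ⟨N, hN⟩ := hs (ε ^ 2) (by positivity)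
    refine ⟨N, fun m hm n hn => ?_⟩
    have := hN m hm n hn
    rw [hp] at this
    rw [dist_eq_norm]
    exact lt_of_pow_lt_pow_left₀ 2 hε.le this
  obtain ⟨x, hx⟩ := cauchySeq_tendsto_of_complete hc
  refine ⟨x, fun ε hε => ?_⟩
  obtain ⟨N, hN⟩ := Metric.tendsto_atTop.mp hx (Real.sqrt ε) (Real.sqrt_pos.mpr hε)
  refine ⟨N, fun n hn => ?_⟩
  have := hN n hn
  rw [dist_eq_norm] at this
  rw [hp]
  calc ‖s n - x‖ ^ 2 < Real.sqrt ε ^ 2 := by gcongr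
    _ = ε := Real.sq_sqrt hε.le

theorem IsCompleteForm.of_equiv {X Y : Type u} [AddCommGroup X] [Module ℂ X] [AddCommGroup Y]
    [Module ℂ Y] {p : X → X → A} {q : Y → Y → A} (hp : IsCompleteForm p) (ρ : X ≃ₗ[ℂ] Y)
    (h : ∀ x y, q (ρ x) (ρ y) = p x y) : IsCompleteForm q := fun s hs => by
  have e : ∀ y y', q y y' = p (ρ.symm y) (ρ.symm y') := fun y y' => by simp [← h]
  obtain ⟨x, hx⟩ := hp (fun n => ρ.symm (s n)) (by simpa only [e, map_sub] using hs)
  refine ⟨ρ x, ?_⟩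
  simpa only [e, map_sub, LinearEquiv.symm_apply_apply] using hx

/-- This allows the axioms for `X_B` to be checked on the kernel of `E`, inside `B`, instead of on
operators. -/
theorem BimoduleData.IsInvolutive.of_isomorphic {X Y : BimoduleData A} (hX : X.IsInvolutive)
    (h : X.Isomorphic Y) : Y.IsInvolutive := by
  obtain ⟨ρ, hl, hr, hL, hR, hs⟩ := h
  have sL : {a | ∃ x y, Y.linner x y = a} = {a | ∃ x y, X.linner x y = a} := by
    ext a
    exact ⟨fun ⟨x, y, e⟩ => ⟨ρ.symm x, ρ.symm y, by rw [← hL]; simpa using e⟩,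
      fun ⟨x, y, e⟩ => ⟨ρ x, ρ y, by rw [hL, e]⟩⟩
  have sR : {a | ∃ x y, Y.rinner x y = a} = {a | ∃ x y, X.rinner x y = a} := by
    ext a
    exact ⟨fun ⟨x, y, e⟩ => ⟨ρ.symm x, ρ.symm y, by rw [← hR]; simpa using e⟩,
      fun ⟨x, y, e⟩ => ⟨ρ x, ρ y, by rw [hR, e]⟩⟩
  constructor
  · constructor
    case linner_complete => exact hX.linner_complete.of_equiv ρ hL
    case rinner_complete => exact hX.rinner_complete.of_equiv ρ hR
    case linner_full => rw [sL]; exact hX.linner_full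
    case rinner_full => rw [sR]; exact hX.rinner_full
    -- Surjectivity of `ρ` turns quantifiers over `Y` into quantifiers over `X`, and each remaining
    -- axiom becomes literally that of `X`.
    all_goals simp only [ρ.surjective.forall, ← hl, ← hr, ← map_add, ← map_smul, hL, hR,
      EmbeddingLike.apply_eq_iff_eq, EmbeddingLike.map_eq_zero_iff]
    · exact hX.one_lact
    · exact hX.mul_lact
    · exact hX.add_lact
    · exact hX.lact_add
    · exact hX.smul_lact
    · exact hX.ract_one
    · exact hX.ract_mul
    · exact hX.ract_add
    · exact hX.add_ract
    · exact hX.ract_smul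
    · exact hX.lact_ract
    · exact hX.linner_add
    · exact hX.linner_lact
    · exact hX.star_linner
    · exact hX.linner_self
    · exact hX.eq_zero_of_linner
    · exact hX.linner_ract
    · exact hX.rinner_add
    · exact hX.rinner_ract
    · exact hX.star_rinner
    · exact hX.rinner_self
    · exact hX.eq_zero_of_rinner
    · exact hX.rinner_lact
    · exact hX.linner_lact_eq
  all_goals simp only [ρ.surjective.forall, ← hl, ← hr, ← map_add, ← map_smul, hL, hR, ← hs,
    EmbeddingLike.apply_eq_iff_eq]
  · exact hX.sharp_add
  · exact hX.sharp_smul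
  · exact hX.sharp_sharp
  · exact hX.sharp_act
  · exact hX.linner_sharp

theorem BimoduleData.Isomorphic.symm {X Y : BimoduleData A} (h : X.Isomorphic Y) :
    Y.Isomorphic X := by
  obtain ⟨ρ, hl, hr, hL, hR, hs⟩ := h
  refine ⟨ρ.symm, ?_, ?_, ?_, ?_, ?_⟩
  · intro a; simp [ρ.surjective.forall, ← hl]
  · simp [ρ.surjective.forall, ← hr]
  · simp [ρ.surjective.forall, hL]
  · simp [ρ.surjective.forall, hR]
  · simp [ρ.surjective.forall, ← hs]

theorem BimoduleData.Isomorphic.trans {X Y Z : BimoduleData A} (h : X.Isomorphic Y)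
    (h' : Y.Isomorphic Z) : X.Isomorphic Z := by
  obtain ⟨ρ, hl, hr, hL, hR, hs⟩ := h
  obtain ⟨ρ', hl', hr', hL', hR', hs'⟩ := h'
  refine ⟨ρ.trans ρ', ?_, ?_, ?_, ?_, ?_⟩ <;> simp [*]

/-- The span is in fact all of `A`, because `a = ∑ a s i`. -/
theorem dense_span_of_sum_eq_one {S : Set A} {ι : Type*} [Fintype ι] (s : ι → A)
    (hs : ∀ i a, a * s i ∈ S) (h1 : ∑ i, s i = 1) : Dense (Submodule.span ℂ S : Set A) := by
  have : Submodule.span ℂ S = ⊤ := by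
    refine Submodule.eq_top_iff'.mpr fun a => ?_
    rw [← mul_one a, ← h1, Finset.mul_sum]
    exact Submodule.sum_mem _ fun i _ => Submodule.subset_span (hs i a)
  rw [this]
  exact dense_univ

theorem InnerSystem.symm_map_comm (S : InnerSystem A) (a : A) :
    (S.z : A) * S.α.symm a = S.α a * S.z := by
  have h := S.map_map (S.α.symm a)
  rw [StarAlgEquiv.apply_symm_apply] at h
  rw [h, mul_assoc, Unitary.coe_star_mul_self, mul_one]

/-- The bimodules `X_α` are involutive equivalence bimodules. -/
theorem InnerSystem.bimodule_isInvolutive (S : InnerSystem A) : S.bimodule.IsInvolutive := by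
  -- Automorphisms are isometric, so both inner products induce the norm of `A`.
  have hnorm : ∀ a : A, ‖S.α.symm a‖ = ‖a‖ := fun a => NonUnitalStarAlgHom.norm_map S.α.symm
    S.α.symm.injective a
  have hzz : star (S.z : A) * S.z = 1 := Unitary.coe_star_mul_self S.z
  constructor
  · constructor
    case linner_complete =>
      exact isCompleteForm_of_norm_sq (X := A) (p := fun x y => x * star y) fun x => by
        rw [CStarRing.norm_self_mul_star, sq]
    case rinner_complete =>
      exact isCompleteForm_of_norm_sq (X := A) (p := fun x y => S.α.symm (star x * y)) fun x => by
        rw [hnorm, CStarRing.norm_star_mul_self, sq]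
    case linner_full =>
      refine dense_span_of_sum_eq_one (ι := Unit) (fun _ => 1) (fun _ a => ?_) (by simp)
      exact ⟨(a : A), (1 : A), by simp [InnerSystem.bimodule]⟩
    case rinner_full =>
      refine dense_span_of_sum_eq_one (ι := Unit) (fun _ => 1) (fun _ a => ?_) (by simp)
      exact ⟨(1 : A), (S.α a : A), by simp [InnerSystem.bimodule]⟩
    case linner_self =>
      exact fun (x : A) => ⟨star x, show x * star x = _ by rw [star_star]⟩
    case rinner_self =>
      exact fun (x : A) => ⟨S.α.symm x, show S.α.symm (star x * x) = _ by
        rw [map_mul, map_star]⟩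
    case eq_zero_of_linner =>
      exact fun (x : A) (h : x * star x = 0) => (CStarRing.mul_star_self_eq_zero_iff x).mp h
    case eq_zero_of_rinner =>
      exact fun (x : A) (h : S.α.symm (star x * x) = 0) =>
        (CStarRing.star_mul_self_eq_zero_iff x).mp ((EmbeddingLike.map_eq_zero_iff).mp h)
    case linner_lact_eq =>
      exact fun (x y z : A) => by simp [InnerSystem.bimodule, mul_assoc]
    case add_lact => exact fun a b (x : A) => add_mul a b x
    case lact_add => exact fun a (x y : A) => mul_add a x y
    case smul_lact => exact fun c a (x : A) => smul_mul_assoc c a x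
    case ract_add =>
      exact fun (x : A) a b => show x * S.α (a + b) = x * S.α a + x * S.α b by rw [map_add, mul_add]
    case add_ract => exact fun (x y : A) a => add_mul x y (S.α a)
    case ract_smul =>
      exact fun (x : A) c a => show x * S.α (c • a) = c • (x * S.α a) by
        rw [map_smul, mul_smul_comm]
    case linner_add => exact fun (x y z : A) => add_mul x y (star z)
    case rinner_add =>
      exact fun (x y z : A) => show S.α.symm (star x * (y + z)) = _ by
        rw [mul_add, map_add]; rfl
    all_goals simp [InnerSystem.bimodule, mul_assoc, map_star]
  · exact fun (x y : A) => show star (S.z : A) * S.α (star (x + y))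
      = star (S.z : A) * S.α (star x) + star (S.z : A) * S.α (star y) by
      rw [star_add, map_add, mul_add]
  · exact fun c (x : A) => show star (S.z : A) * S.α (star (c • x))
      = star c • (star (S.z : A) * S.α (star x)) by
      rw [star_smul, map_smul, mul_smul_comm]
  -- Here `x♯♯ = z⋆ α²(x) α(z) = z⋆ (z x z⋆) z = x`.
  · intro (x : A)
    change star (S.z : A) * S.α (star (star (S.z : A) * S.α (star x))) = x
    rw [star_mul, star_star, map_mul, S.map_z, ← map_star, star_star, S.map_map,
      mul_assoc (S.z * x : A), hzz, mul_one, ← mul_assoc, hzz, one_mul]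
  · intro a (x : A) b
    change star (S.z : A) * S.α (star (a * x * S.α b))
      = star b * (star (S.z : A) * S.α (star x)) * S.α (star a)
    simp only [star_mul, ← map_star, map_mul, S.map_map]
    rw [mul_assoc (S.z : A), ← mul_assoc (star (S.z : A)), ← mul_assoc (star (S.z : A)), hzz]
    simp only [one_mul, mul_assoc]
  -- Both sides equal `x α(y) z`; on the right, `x z α⁻¹(y)` is rewritten by `α² = Ad(z)`.
  · intro (x : A) (y : A)
    change x * star (star (S.z : A) * S.α (star y))
      = S.α.symm (star (star (S.z : A) * S.α (star x)) * y)
    have hz' : S.α.symm (S.z : A) = S.z := by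
      rw [← S.map_z, StarAlgEquiv.symm_apply_apply, S.map_z]
    rw [star_mul, star_mul, star_star, ← map_star, ← map_star, star_star, star_star, map_mul,
      map_mul, StarAlgEquiv.symm_apply_apply, hz', mul_assoc, S.symm_map_comm]

end Transfer

/-! ## The basic construction of an expectation of index two -/

section Basic

variable {B : Type u} [CStarAlgebra B] {A : StarSubalgebra ℂ B} (E : CondExp A)

theorem CondExp.star_leftMul (b : B) : star (E.leftMul b) = E.leftMul (star b) := by
  ext x
  · rfl
  · change b * x = star (star b) * x
    rw [star_star]

theorem CondExp.star_jones : star E.jones = E.jones := rfl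

theorem CondExp.leftMul_add (b c : B) : E.leftMul (b + c) = E.leftMul b + E.leftMul c := by
  ext x
  · exact add_mul b c x
  · change star (b + c) * x = star b * x + star c * x
    rw [star_add, add_mul]

theorem CondExp.leftMul_smul (r : ℂ) (b : B) : E.leftMul (r • b) = r • E.leftMul b := by
  ext x
  · exact smul_mul_assoc r b x
  · change star (r • b) * x = star r • (star b * x)
    rw [star_smul, smul_mul_assoc]

theorem CondExp.op_congr {S T : E.Adjointable} (h : S = T) (x : B) : S.op x = T.op x := by
  rw [h]

theorem CondExp.jones_leftMul_jones (b : B) : E.jones * E.leftMul b * E.jones = E.psi (E b) := by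
  have h : ∀ c x : B, (E (c * (E x : B)) : B) = (E c : B) * (E x : B) := fun c x => by
    rw [E.apply_mul_coe]; rfl
  ext x
  · exact h b x
  · change (E (star b * (E x : B)) : B) = (E (star (E b : B) * x) : B)
    rw [h, E.coe_map_star, ← StarMemClass.coe_star, E.apply_coe_mul]
    rfl

theorem CondExp.psi_one : E.psi 1 = E.jones := by
  rw [CondExp.psi, OneMemClass.coe_one, E.leftMul_one, one_mul]

theorem CondExp.phi_one : E.phi 1 = 1 - E.jones := by
  rw [CondExp.phi, OneMemClass.coe_one, E.leftMul_one, one_mul]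

theorem CondExp.psi_injective : Function.Injective E.psi := fun a b h => by
  have h1 := E.op_congr h 1
  change (a : B) * (E 1 : B) = (b : B) * (E 1 : B) at h1
  rw [E.apply_one, OneMemClass.coe_one, mul_one, mul_one] at h1
  exact Subtype.ext h1

theorem CondExp.symmetry_op (x : B) : E.symmetry.op x = (E x : B) + (E x : B) - x := by
  rw [CondExp.symmetry, two_mul]
  rfl

theorem CondExp.compl_jones_mul_self : (1 - E.jones) * (1 - E.jones) = 1 - E.jones := by
  rw [mul_sub, mul_one, sub_mul, one_mul, E.jones_mul_jones, sub_self, sub_zero]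

variable {E}

/-- On the kernel `1 - e_A` is the identity, so `a (1 - e_A)` acts there as left multiplication by
`a`. -/
theorem CondExp.HasIndex.phi_injective [IsClosed (A : Set B)] (hE : E.HasIndex 2) :
    Function.Injective E.phi := fun a b h => by
  refine Subtype.ext (sub_eq_zero.mp (hE.eq_zero_of_mul_kernel fun x hx => ?_))
  have h1 := E.op_congr h x
  change (a : B) * (x - (E x : B)) = (b : B) * (x - (E x : B)) at h1
  rw [E.mem_kernel.mp hx, ZeroMemClass.coe_zero, sub_zero] at h1
  rw [sub_mul, h1, sub_self]

/-- Faithfulness makes the inner product nondegenerate, so the adjoint stored with an operator is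
determined by it. -/
theorem CondExp.HasIndex.adjointable_ext [IsClosed (A : Set B)] {c : B} (hE : E.HasIndex c)
    {S T : E.Adjointable} (h : ∀ x, S.op x = T.op x) : S = T := by
  refine Adjointable.ext (LinearMap.ext h) (LinearMap.ext fun y => ?_)
  refine sub_eq_zero.mp (hE.faithful ?_)
  rw [mul_sub, map_sub, ← S.inner_op, ← T.inner_op, h, sub_self]

theorem CondExp.HasIndex.eq_zero_of_star_mul_self [IsClosed (A : Set B)] {c : B}
    (hE : E.HasIndex c) {T : E.Adjointable} (h : star T * T = 0) : T = 0 := by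
  refine hE.adjointable_ext fun x => hE.faithful ?_
  rw [T.inner_op]
  have h1 : T.adj (T.op x) = 0 := E.op_congr h x
  rw [h1, mul_zero, map_zero]

/-- The left side is `x⋆ e_A y`. With `b' = b - E(b)` one has `E(y b) = E(y b') = y b'`, as `y E(b)`
is odd and `y b'` is even; hence `b` is sent to `x⋆ y b'`. -/
theorem CondExp.HasIndex.star_jones_leftMul_mul [IsClosed (A : Set B)] (hE : E.HasIndex 2)
    {x y : B} (hx : x ∈ E.kernel) (hy : y ∈ E.kernel) :
    star (E.jones * E.leftMul x) * (E.jones * E.leftMul y) = E.phi (E (star x * y)) := by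
  rw [star_mul, E.star_leftMul, E.star_jones, mul_assoc, ← mul_assoc E.jones, E.jones_mul_jones]
  refine hE.adjointable_ext fun b => ?_
  change star x * (E (y * b) : B) = (E (star x * y) : B) * (b - (E b : B))
  have h1 : E (y * b) = E (y * (b - (E b : B))) := by
    rw [mul_sub, map_sub, E.apply_mul_coe, E.mem_kernel.mp hy, zero_mul, sub_zero]
  rw [h1, hE.kernel_mul_kernel hy (E.sub_apply_mem_kernel b),
    hE.kernel_mul_kernel (E.star_mem_kernel hx) hy, mul_assoc]

theorem CondExp.jones_leftMul_mul_star (x y : B) :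
    (E.jones * E.leftMul x) * star (E.jones * E.leftMul y) = E.psi (E (x * star y)) := by
  rw [star_mul, E.star_leftMul, E.star_jones, ← mul_assoc, mul_assoc E.jones, ← E.leftMul_mul,
    E.jones_leftMul_jones]

/-- An operator from `ker E` to `A` is a product `e_A k` with `k` in the kernel. -/
theorem CondExp.HasIndex.exists_kernel_of_corner [IsClosed (A : Set B)] {c : B}
    (hE : E.HasIndex c) {T : E.Adjointable} (hT : E.jones * T * (1 - E.jones) = T) :
    ∃ k ∈ E.kernel, T = E.jones * E.leftMul k := by
  have h1 : ∀ x, (E (T.op x) : B) = T.op x := fun x => by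
    have := E.op_congr (S := E.jones * T) (T := T) (by
      rw [← hT, ← mul_assoc, ← mul_assoc, E.jones_mul_jones]) x
    exact this
  have h2 : ∀ x, T.adj x - (E (T.adj x) : B) = T.adj x := fun x => by
    have hs : T * (1 - E.jones) = T := by
      rw [← hT, mul_assoc, E.compl_jones_mul_self]
    exact congrArg (fun S : E.Adjointable => S.adj x) hs
  -- A Riesz argument: `T` takes values in `A`, so `T x = E(T x) = ⟨1, T x⟩ = ⟨T⋆ 1, x⟩ = E((T⋆ 1)⋆
  -- x)`.
  refine ⟨star (T.adj 1), ?_, hE.adjointable_ext fun x => ?_⟩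
  · rw [← h2 1]
    exact E.star_mem_kernel (E.sub_apply_mem_kernel _)
  · change T.op x = (E (star (T.adj 1) * x) : B)
    have e : E (star (T.adj 1) * x) = E (T.op x) := by
      have h3 := (star T).inner_op 1 x
      rw [star_one, one_mul] at h3
      exact h3
    rw [e, h1]

/-- Since `e_A k e_A = E(k) e_A = 0`, cutting by `1 - e_A` on the right changes nothing. -/
theorem CondExp.jones_leftMul_mem_corner [IsClosed (A : Set B)] {k : B} (hk : k ∈ E.kernel) :
    E.jones * E.leftMul k ∈ E.corner := by
  refine ⟨E.basicSpan_le (Submodule.subset_span ⟨1, k, by rw [E.leftMul_one, one_mul]⟩), ?_⟩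
  have h0 : E.psi 0 = 0 := by
    rw [← E.mem_kernel.mp hk, ← E.jones_leftMul_jones]
    ext x
    · change (E (k * (E x : B)) : B) = 0
      rw [E.apply_mul_coe, E.mem_kernel.mp hk, zero_mul, ZeroMemClass.coe_zero]
    · change (E (star k * (E x : B)) : B) = 0
      rw [E.apply_mul_coe, E.mem_kernel.mp (E.star_mem_kernel hk), zero_mul, ZeroMemClass.coe_zero]
  rw [← mul_assoc, E.jones_mul_jones, mul_sub, mul_one, E.jones_leftMul_jones,
    E.mem_kernel.mp hk, h0, sub_zero]

theorem CondExp.jones_leftMul_injective {k l : B}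
    (h : E.jones * E.leftMul k = E.jones * E.leftMul l) : k = l := by
  have h1 : star k * (E 1 : B) = star l * (E 1 : B) :=
    congrArg (fun S : E.Adjointable => S.adj 1) h
  rw [E.apply_one, OneMemClass.coe_one, mul_one, mul_one] at h1
  exact star_injective h1

/-- The chosen decomposition is the given one: `U` fixes `1` and is `-1` on the kernel, so the
operator determines `b + c` and `b - c`. -/
theorem CondExp.HasIndex.dualAut_apply [IsClosed (A : Set B)] (hE : E.HasIndex 2) (b c : B) :
    E.dualAut (E.leftMul b + E.leftMul c * E.symmetry)
      = E.leftMul b - E.leftMul c * E.symmetry := by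
  have h : ∃ p : B × B, E.leftMul b + E.leftMul c * E.symmetry
      = E.leftMul p.1 + E.leftMul p.2 * E.symmetry := ⟨(b, c), rfl⟩
  rw [CondExp.dualAut, dif_pos h]
  set p := h.choose with hp
  have key : ∀ x, b * x + c * E.symmetry.op x = p.1 * x + p.2 * E.symmetry.op x :=
    E.op_congr h.choose_spec
  simp only [E.symmetry_op] at key
  have k1 : b + c = p.1 + p.2 := by
    have := key 1
    rwa [E.apply_one, OneMemClass.coe_one, add_sub_cancel_right, mul_one, mul_one, mul_one,
      mul_one] at this
  have k2 : b - c = p.1 - p.2 := by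
    refine sub_eq_zero.mp (hE.eq_zero_of_mul_kernel fun x hx => ?_)
    have := key x
    rw [E.mem_kernel.mp hx, ZeroMemClass.coe_zero, add_zero, zero_sub, mul_neg, mul_neg,
      ← sub_eq_add_neg, ← sub_eq_add_neg, ← sub_mul, ← sub_mul] at this
    rw [sub_mul, this, sub_self]
  have k3 : (2 : ℂ) • b = (2 : ℂ) • p.1 := by
    calc (2 : ℂ) • b = (b + c) + (b - c) := by module
      _ = (2 : ℂ) • p.1 := by rw [k1, k2]; module
  have hb : b = p.1 := smul_right_injective _ (two_ne_zero) k3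
  have hc : c = p.2 := by rw [hb] at k1; exact add_left_cancel k1
  rw [← hb, ← hc]

theorem CondExp.HasIndex.dualAut_leftMul_jones [IsClosed (A : Set B)] (hE : E.HasIndex 2) (b : B) :
    E.dualAut (E.leftMul b * E.jones) = E.leftMul b * (1 - E.jones) := by
  have h2 : (1 / 2 : ℂ) + 1 / 2 = 1 := by norm_num
  have e : ∀ T : E.Adjointable, (1 / 2 : ℂ) • T + (1 / 2 : ℂ) • T = T := fun T => by
    rw [← add_smul, h2, one_smul]
  -- This is `e_A = (1 + U) / 2` multiplied by `b`.
  have e1 : E.leftMul b * E.jones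
      = E.leftMul ((1 / 2 : ℂ) • b) + E.leftMul ((1 / 2 : ℂ) • b) * E.symmetry := by
    rw [E.leftMul_smul, CondExp.symmetry, two_mul, mul_sub, mul_add, mul_one, smul_mul_assoc, e]
    abel
  rw [e1, hE.dualAut_apply, E.leftMul_smul, CondExp.symmetry, two_mul, mul_sub, mul_add, mul_one,
    smul_mul_assoc, e, mul_sub, mul_one, sub_sub_eq_add_sub, e]

end Basic

/-! ## The bimodule of the inclusion -/

section Bimodule

variable {B : Type u} [CStarAlgebra B] {A : StarSubalgebra ℂ B} [IsClosed (A : Set B)]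
  (E : CondExp A)

/-- The kernel of `E` with the inner products `x y⋆`, `x⋆ y` and the involution `x⋆`. -/
noncomputable def CondExp.kernelBimodule : BimoduleData A where
  carrier := E.kernel
  lact a x := ⟨a * x.1, E.coe_mul_mem_kernel a x.2⟩
  ract x a := ⟨x.1 * a, E.mul_coe_mem_kernel x.2 a⟩
  linner x y := E (x.1 * star y.1)
  rinner x y := E (star x.1 * y.1)
  sharp x := ⟨star x.1, E.star_mem_kernel x.2⟩

variable {E}

/-- The isomorphism is `k ↦ e_A k`. -/
theorem CondExp.HasIndex.kernelBimodule_isomorphic (hE : E.HasIndex 2) :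
    E.kernelBimodule.Isomorphic E.bimodule := by
  let f : E.kernel →ₗ[ℂ] E.corner :=
    { toFun := fun k => ⟨E.jones * E.leftMul k, CondExp.jones_leftMul_mem_corner k.2⟩
      map_add' := fun k l => Subtype.ext
        (show E.jones * E.leftMul ((k : B) + l) = _ by rw [E.leftMul_add, mul_add]; rfl)
      map_smul' := fun r k => Subtype.ext
        (show E.jones * E.leftMul (r • (k : B)) = _ by
          rw [E.leftMul_smul, mul_smul_comm]; rfl) }
  have hf : Function.Bijective f := by
    refine ⟨fun k l h => Subtype.ext (CondExp.jones_leftMul_injective (congrArg Subtype.val h)),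
      fun T => ?_⟩
    obtain ⟨k, hk, e⟩ := hE.exists_kernel_of_corner T.2.2
    exact ⟨⟨k, hk⟩, Subtype.ext e.symm⟩
  refine ⟨LinearEquiv.ofBijective f hf, fun a (x : E.kernel) => Subtype.ext ?_,
    fun (x : E.kernel) a => Subtype.ext ?_, fun (x y : E.kernel) => ?_,
    fun (x y : E.kernel) => ?_, fun (x : E.kernel) => Subtype.ext ?_⟩
  · change E.jones * E.leftMul ((a : B) * x) = E.leftMul a * (E.jones * E.leftMul x)
    rw [E.leftMul_mul, ← mul_assoc, ← mul_assoc, E.commute_jones]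
  · change E.jones * E.leftMul ((x : B) * a) = E.jones * E.leftMul x * E.leftMul a
    rw [E.leftMul_mul, mul_assoc]
  · change Function.invFun E.psi ((E.jones * E.leftMul x) * star (E.jones * E.leftMul y))
      = E ((x : B) * star (y : B))
    rw [CondExp.jones_leftMul_mul_star]
    exact Function.leftInverse_invFun E.psi_injective _
  · change Function.invFun E.phi (star (E.jones * E.leftMul x) * (E.jones * E.leftMul y))
      = E (star (x : B) * (y : B))
    rw [hE.star_jones_leftMul_mul x.2 y.2]
    exact Function.leftInverse_invFun hE.phi_injective _
  -- The dual automorphism sends `(e_A x)⋆ = x⋆ e_A` to `x⋆ (1 - e_A)`, and `e_A x⋆ (1 - e_A) = e_A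
  -- x⋆` because `x⋆` is in the kernel.
  · change E.jones * E.leftMul (star (x : B))
      = E.jones * E.dualAut (star (E.jones * E.leftMul x)) * (1 - E.jones)
    have h := (CondExp.jones_leftMul_mem_corner (E.star_mem_kernel x.2)).2
    rw [star_mul, E.star_leftMul, E.star_jones, hE.dualAut_leftMul_jones, ← mul_assoc, mul_assoc,
      E.compl_jones_mul_self]
    rw [← mul_assoc, E.jones_mul_jones] at h
    exact h.symm

/-- Products of two kernel elements are already in `A`, so `E` acts as the identity in both inner
products. They induce the norm of `B`, for which the kernel is closed, and their compatibility is
associativity in `B`. -/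
theorem CondExp.HasIndex.kernelBimodule_isInvolutive (hE : E.HasIndex 2) :
    E.kernelBimodule.IsInvolutive := by
  have hL : ∀ x y : E.kernel, ((E ((x : B) * star (y : B)) : A) : B) = (x : B) * star (y : B) :=
    fun x y => hE.kernel_mul_kernel x.2 (E.star_mem_kernel y.2)
  have hR : ∀ x y : E.kernel, ((E (star (x : B) * (y : B)) : A) : B) = star (x : B) * (y : B) :=
    fun x y => hE.kernel_mul_kernel (E.star_mem_kernel x.2) y.2
  have hcl : IsClosed (E.kernel : Set B) := E.isClosed_kernel
  have hcomplete : CompleteSpace E.kernel := hcl.completeSpace_coe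
  obtain ⟨n, c, hc, h1, -, -⟩ := hE.exists_kernel_frame
  have hsum : ∑ k, E (c k * star (c k)) = 1 := by rw [← map_sum, h1, E.apply_one]
  constructor
  · constructor
    case linner_complete =>
      refine isCompleteForm_of_norm_sq (X := E.kernel) (p := fun x y => E (x.1 * star y.1))
        fun x => ?_
      change ‖((E ((x : B) * star (x : B)) : A) : B)‖ = ‖(x : B)‖ ^ 2
      rw [hL, CStarRing.norm_self_mul_star, sq]
    case rinner_complete =>
      refine isCompleteForm_of_norm_sq (X := E.kernel) (p := fun x y => E (star x.1 * y.1))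
        fun x => ?_
      change ‖((E (star (x : B) * (x : B)) : A) : B)‖ = ‖(x : B)‖ ^ 2
      rw [hR, CStarRing.norm_star_mul_self, sq]
    case linner_full =>
      refine dense_span_of_sum_eq_one _ (fun k a => ?_) hsum
      -- The left product of `a c k` and `c k` is `a E(c k c k⋆)`; the adjoints of these two vectors
      -- have the same right product.
      refine ⟨(⟨a * c k, E.coe_mul_mem_kernel a (hc k)⟩ : E.kernel), (⟨c k, hc k⟩ : E.kernel), ?_⟩
      change E ((a : B) * c k * star (c k)) = _
      rw [mul_assoc, E.apply_coe_mul]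
    case rinner_full =>
      refine dense_span_of_sum_eq_one _ (fun k a => ?_) hsum
      refine ⟨(⟨star ((a : B) * c k), E.star_mem_kernel (E.coe_mul_mem_kernel a (hc k))⟩ : E.kernel),
        (⟨star (c k), E.star_mem_kernel (hc k)⟩ : E.kernel), ?_⟩
      change E (star (star ((a : B) * c k)) * star (c k)) = _
      rw [star_star, mul_assoc, E.apply_coe_mul]
    case linner_self =>
      intro (x : E.kernel)
      obtain ⟨d, hd⟩ := E.apply_star_mul_self (star (x : B))
      rw [star_star] at hd
      exact ⟨d, hd⟩
    case rinner_self => exact fun (x : E.kernel) => E.apply_star_mul_self (x : B)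
    case eq_zero_of_linner =>
      intro (x : E.kernel) (h : E ((x : B) * star (x : B)) = 0)
      refine Subtype.ext (star_eq_zero.mp (hE.faithful (b := star (x : B)) ?_))
      rw [star_star, h]
    case eq_zero_of_rinner =>
      exact fun (x : E.kernel) (h : E (star (x : B) * (x : B)) = 0) => Subtype.ext (hE.faithful h)
    case linner_lact_eq =>
      intro (x : E.kernel) (y : E.kernel) (z : E.kernel)
      refine Subtype.ext ?_
      change (E ((x : B) * star (y : B)) : B) * z = x * (E (star (y : B) * (z : B)) : B)
      rw [hL, hR, mul_assoc]
    case one_lact => exact fun (x : E.kernel) => Subtype.ext (one_mul (x : B))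
    case mul_lact => exact fun a b (x : E.kernel) => Subtype.ext (mul_assoc (a : B) b x)
    case add_lact => exact fun a b (x : E.kernel) => Subtype.ext (add_mul (a : B) b x)
    case lact_add => exact fun a (x y : E.kernel) => Subtype.ext (mul_add (a : B) x y)
    case smul_lact => exact fun r a (x : E.kernel) => Subtype.ext (smul_mul_assoc r (a : B) x)
    case ract_one => exact fun (x : E.kernel) => Subtype.ext (mul_one (x : B))
    case ract_mul => exact fun (x : E.kernel) a b => Subtype.ext (mul_assoc (x : B) a b).symm
    case ract_add => exact fun (x : E.kernel) a b => Subtype.ext (mul_add (x : B) a b)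
    case add_ract => exact fun (x y : E.kernel) a => Subtype.ext (add_mul (x : B) y a)
    case ract_smul => exact fun (x : E.kernel) r a => Subtype.ext (mul_smul_comm r (x : B) a)
    case lact_ract => exact fun a (x : E.kernel) b => Subtype.ext (mul_assoc (a : B) x b)
    case linner_add =>
      exact fun (x y z : E.kernel) => show E (((x : B) + y) * star (z : B)) = _ by
        rw [add_mul, map_add]; rfl
    case linner_lact =>
      exact fun a (x y : E.kernel) => show E ((a : B) * x * star (y : B)) = _ by
        rw [mul_assoc, E.apply_coe_mul]; rfl
    case star_linner =>
      exact fun (x y : E.kernel) => show star (E ((x : B) * star (y : B))) = _ by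
        rw [← E.map_star, star_mul, star_star]; rfl
    case linner_ract =>
      exact fun (x y : E.kernel) a => show E ((x : B) * a * star (y : B))
        = E ((x : B) * star ((y : B) * ((star a : A) : B))) by
        rw [star_mul, StarMemClass.coe_star, star_star, mul_assoc]
    case rinner_add =>
      exact fun (x y z : E.kernel) => show E (star (x : B) * ((y : B) + z)) = _ by
        rw [mul_add, map_add]; rfl
    case rinner_ract =>
      exact fun (x y : E.kernel) a => show E (star (x : B) * ((y : B) * a)) = _ by
        rw [← mul_assoc, E.apply_mul_coe]; rfl
    case star_rinner =>
      exact fun (x y : E.kernel) => show star (E (star (x : B) * (y : B))) = _ by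
        rw [← E.map_star, star_mul, star_star]; rfl
    case rinner_lact =>
      exact fun a (x y : E.kernel) => show E (star ((a : B) * x) * y)
        = E (star (x : B) * (((star a : A) : B) * y)) by
        rw [star_mul, StarMemClass.coe_star, mul_assoc]
  · exact fun (x y : E.kernel) => Subtype.ext (star_add (x : B) y)
  · exact fun r (x : E.kernel) => Subtype.ext (star_smul r (x : B))
  · exact fun (x : E.kernel) => Subtype.ext (star_star (x : B))
  · exact fun a (x : E.kernel) b => Subtype.ext (show star ((a : B) * x * b)
      = ((star b : A) : B) * star (x : B) * ((star a : A) : B) by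
        rw [star_mul, star_mul, StarMemClass.coe_star, StarMemClass.coe_star, mul_assoc])
  · exact fun (x y : E.kernel) => show E ((x : B) * star (star (y : B)))
      = E (star (star (x : B)) * (y : B)) by rw [star_star, star_star]

end Bimodule

/-! ### Unitaries in the kernel of the expectation -/

section Unitary

variable {B : Type u} [CStarAlgebra B] {A : StarSubalgebra ℂ B} [IsClosed (A : Set B)]
  {E : CondExp A}

/-- `e_A` and `1 - e_A` are equivalent if and only if the kernel of `E` has a unitary. -/
theorem CondExp.HasIndex.mvNEquivalent_iff (hE : E.HasIndex 2) :
    E.MvNEquivalent E.jones (1 - E.jones) ↔ ∃ u ∈ unitary B, u ∈ E.kernel := by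
  constructor
  · rintro ⟨v, -, h1, h2⟩
    -- A partial isometry absorbs its support projections. Hence `v⋆` lies in the corner and has the
    -- form `e_A k`; the two relations for `v` become `k⋆ k = 1` and `k k⋆ = 1`.
    have hve : v = v * E.jones := by
      refine sub_eq_zero.mp (hE.eq_zero_of_star_mul_self ?_)
      rw [star_sub, star_mul, E.star_jones, sub_mul, mul_sub, mul_sub, mul_assoc, mul_assoc,
        ← mul_assoc (star v) v, h1, E.jones_mul_jones, E.jones_mul_jones, sub_self]
    have hev : v = (1 - E.jones) * v := by
      rw [← h2, mul_assoc, h1, ← hve]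
    have hT : E.jones * star v * (1 - E.jones) = star v := by
      have hc : star (1 - E.jones) = 1 - E.jones := by rw [star_sub, star_one, E.star_jones]
      have e1 : star v = E.jones * star v := by
        conv_lhs => rw [hve, star_mul, E.star_jones]
      have e2 : star v = star v * (1 - E.jones) := by
        conv_lhs => rw [hev, star_mul, hc]
      rw [← e1, ← e2]
    obtain ⟨k, hk, hv⟩ := hE.exists_kernel_of_corner hT
    have hv' : v = star (E.jones * E.leftMul k) := by rw [← hv, star_star]
    refine ⟨k, Unitary.mem_iff.mpr ⟨?_, ?_⟩, hk⟩
    · rw [hv', star_star, hE.star_jones_leftMul_mul hk hk, ← E.phi_one] at h2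
      rw [← hE.kernel_mul_kernel (E.star_mem_kernel hk) hk, hE.phi_injective h2]
      rfl
    · rw [hv', star_star, E.jones_leftMul_mul_star, ← E.psi_one] at h1
      rw [← hE.kernel_mul_kernel hk (E.star_mem_kernel hk), E.psi_injective h1]
      rfl
  · rintro ⟨u, hu, hk⟩
    obtain ⟨hu1, hu2⟩ := Unitary.mem_iff.mp hu
    refine ⟨star (E.jones * E.leftMul u), E.basicSpan_le (Submodule.subset_span
      ⟨star u, 1, by rw [star_mul, E.star_leftMul, E.star_jones, E.leftMul_one, mul_one]⟩), ?_, ?_⟩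
    · rw [star_star, E.jones_leftMul_mul_star, hu2, E.apply_one, E.psi_one]
    · rw [star_star, hE.star_jones_leftMul_mul hk hk, hu1, E.apply_one, E.phi_one]

/-- At `b = 1` the expansion gives `u E(u⋆) = 0`. Conversely, if `u` is in the kernel and `x = b -
E(b)`, then `u E(u⋆ b) = u u⋆ x = x`, and similarly on the other side. -/
theorem CondExp.HasIndex.exists_quasiBasis_iff (hE : E.HasIndex 2) :
    (∃ u ∈ unitary B, E.IsQuasiBasis ![1, u] ![1, star u])
      ↔ ∃ u ∈ unitary B, u ∈ E.kernel := by
  refine exists_congr fun u => and_congr_right fun hu => ?_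
  obtain ⟨hu1, hu2⟩ := Unitary.mem_iff.mp hu
  simp only [CondExp.IsQuasiBasis, Fin.sum_univ_two, Matrix.cons_val_zero, Matrix.cons_val_one,
    one_mul, mul_one]
  constructor
  · intro h
    have h1 := (h 1).1
    rw [E.apply_one, OneMemClass.coe_one, mul_one, add_eq_left] at h1
    have h2 : (E (star u) : B) = 0 := by
      rw [← one_mul (E (star u) : B), ← hu1, mul_assoc, h1, mul_zero]
    rw [← star_star u]
    exact E.star_mem_kernel (Subtype.ext h2)
  · intro hk b
    have hk' := E.star_mem_kernel hk
    set x := b - (E b : B) with hx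
    have hxk : x ∈ E.kernel := E.sub_apply_mem_kernel b
    have hb : b = (E b : B) + x := by rw [hx]; abel
    have e1 : E (star u * b) = E (star u * x) := by
      rw [hx, mul_sub, map_sub, E.apply_mul_coe, E.mem_kernel.mp hk', zero_mul, sub_zero]
    have e2 : E (b * u) = E (x * u) := by
      rw [hx, sub_mul, map_sub, E.apply_coe_mul, E.mem_kernel.mp hk, mul_zero, sub_zero]
    rw [e1, e2, hE.kernel_mul_kernel hk' hxk, hE.kernel_mul_kernel hxk hk, ← mul_assoc, hu2,
      mul_assoc, hu2, one_mul, mul_one]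
    exact ⟨hb.symm, hb.symm⟩

/-- The automorphism `Ad(u)` of `A`, for a unitary `u` in the kernel of `E`. -/
noncomputable def CondExp.HasIndex.conjAut (hE : E.HasIndex 2) {u : B} (hu : u ∈ unitary B)
    (hk : u ∈ E.kernel) : A ≃⋆ₐ[ℂ] A :=
  have h1 : star u * u = 1 := (Unitary.mem_iff.mp hu).1
  have h2 : u * star u = 1 := (Unitary.mem_iff.mp hu).2
  have hconj : ∀ a : A, (E (u * a * star u) : B) = u * a * star u := fun a =>
    hE.kernel_mul_kernel (E.mul_coe_mem_kernel hk a) (E.star_mem_kernel hk)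
  have hconj' : ∀ a : A, (E (star u * a * u) : B) = star u * a * u := fun a =>
    hE.kernel_mul_kernel (E.mul_coe_mem_kernel (E.star_mem_kernel hk) a) hk
  { toFun := fun a => E (u * a * star u)
    invFun := fun a => E (star u * a * u)
    left_inv := fun a => Subtype.ext (by
      rw [hconj', hconj]
      calc star u * (u * a * star u) * u = (star u * u) * a * (star u * u) := by noncomm_ring
        _ = a := by rw [h1, one_mul, mul_one])
    right_inv := fun a => Subtype.ext (by
      rw [hconj, hconj']
      calc u * (star u * a * u) * star u = (u * star u) * a * (u * star u) := by noncomm_ring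
        _ = a := by rw [h2, one_mul, mul_one])
    map_mul' := fun a b => Subtype.ext (by
      refine (hconj (a * b)).trans (Eq.trans ?_ (congrArg₂ (· * ·) (hconj a) (hconj b)).symm)
      calc u * ((a * b : A) : B) * star u = u * a * 1 * b * star u := by
            rw [mul_one, MulMemClass.coe_mul, ← mul_assoc u]
        _ = u * a * star u * (u * b * star u) := by rw [← h1]; noncomm_ring)
    map_add' := fun a b => by
      rw [AddMemClass.coe_add, mul_add, add_mul, map_add]
    map_star' := fun a => by
      rw [← E.map_star, star_mul, star_mul, star_star, StarMemClass.coe_star, mul_assoc]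
    map_smul' := fun r a => by
      rw [SetLike.val_smul, mul_smul_comm, smul_mul_assoc, map_smul] }

theorem CondExp.HasIndex.coe_conjAut (hE : E.HasIndex 2) {u : B} (hu : u ∈ unitary B)
    (hk : u ∈ E.kernel) (a : A) : (hE.conjAut hu hk a : B) = u * a * star u :=
  hE.kernel_mul_kernel (E.mul_coe_mem_kernel hk a) (E.star_mem_kernel hk)

/-- The `2ℤ`-inner system given by `Ad(u)` and `u ^ 2`, for a unitary `u` in the kernel of `E`. -/
noncomputable def CondExp.HasIndex.innerSystem (hE : E.HasIndex 2) {u : B} (hu : u ∈ unitary B)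
    (hk : u ∈ E.kernel) : InnerSystem A :=
  have h1 : star u * u = 1 := (Unitary.mem_iff.mp hu).1
  have h2 : u * star u = 1 := (Unitary.mem_iff.mp hu).2
  have hz : (E (u * u) : B) = u * u := hE.kernel_mul_kernel hk hk
  { α := hE.conjAut hu hk
    z := ⟨E (u * u), Unitary.mem_iff.mpr ⟨Subtype.ext (by
        rw [MulMemClass.coe_mul, StarMemClass.coe_star, hz, star_mul]
        calc star u * star u * (u * u) = star u * (star u * u) * u := by noncomm_ring
          _ = 1 := by rw [h1, mul_one, h1]), Subtype.ext (by
        rw [MulMemClass.coe_mul, StarMemClass.coe_star, hz, star_mul]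
        calc u * u * (star u * star u) = u * (u * star u) * star u := by noncomm_ring
          _ = 1 := by rw [h2, mul_one, h2])⟩⟩
    map_z := Subtype.ext (by
      rw [hE.coe_conjAut, hz, ← mul_assoc, mul_assoc, h2, mul_one])
    map_map := fun a => Subtype.ext (by
      rw [hE.coe_conjAut, hE.coe_conjAut]
      change _ = (E (u * u) : B) * a * star (E (u * u) : B)
      rw [hz, star_mul]
      noncomm_ring) }

/-- The map is `a ↦ a u`, with inverse `x ↦ x u⋆`. The twists of `X_α` come from moving `u` to the
right: `a u b = a α(b) u` and `(a u)⋆ = z⋆ α(a⋆) u`. -/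
theorem CondExp.HasIndex.innerSystem_isomorphic (hE : E.HasIndex 2) {u : B} (hu : u ∈ unitary B)
    (hk : u ∈ E.kernel) : (hE.innerSystem hu hk).bimodule.Isomorphic E.kernelBimodule := by
  obtain ⟨h1, h2⟩ := Unitary.mem_iff.mp hu
  have hα : ∀ a : A, ((hE.innerSystem hu hk).α a : B) = u * a * star u := hE.coe_conjAut hu hk
  have hz : (((hE.innerSystem hu hk).z : A) : B) = u * u := hE.kernel_mul_kernel hk hk
  have hsymm : ∀ a : A, ((hE.innerSystem hu hk).α.symm a : B) = star u * a * u := fun a =>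
    hE.kernel_mul_kernel (E.mul_coe_mem_kernel (E.star_mem_kernel hk) a) hk
  let ρ : A ≃ₗ[ℂ] E.kernel :=
    { toFun := fun a => ⟨a * u, E.coe_mul_mem_kernel a hk⟩
      invFun := fun x => E (x * star u)
      map_add' := fun a b => Subtype.ext (add_mul (a : B) b u)
      map_smul' := fun r a => Subtype.ext (smul_mul_assoc r (a : B) u)
      left_inv := fun a => by
        change E ((a : B) * u * star u) = a
        rw [mul_assoc, h2, mul_one, E.apply_coe]
      right_inv := fun x => Subtype.ext (by
        change (E ((x : B) * star u) : B) * u = x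
        rw [hE.kernel_mul_kernel x.2 (E.star_mem_kernel hk), mul_assoc, h1, mul_one]) }
  refine ⟨ρ, fun a (x : A) => Subtype.ext (mul_assoc (a : B) x u),
    fun (x : A) a => Subtype.ext ?_, fun (x y : A) => Subtype.ext ?_,
    fun (x y : A) => Subtype.ext ?_, fun (x : A) => Subtype.ext ?_⟩
  · change (x : B) * ((hE.innerSystem hu hk).α a : B) * u = x * u * a
    rw [hα, mul_assoc, mul_assoc _ (star u), h1, mul_one, mul_assoc]
  · change (E ((x : B) * u * star ((y : B) * u)) : B) = x * star (y : B)
    rw [star_mul, mul_assoc, ← mul_assoc u, h2, one_mul, ← StarMemClass.coe_star,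
      ← MulMemClass.coe_mul, E.apply_coe]
  · change (E (star ((x : B) * u) * ((y : B) * u)) : B) = (hE.innerSystem hu hk).α.symm (star x * y)
    rw [hE.kernel_mul_kernel (E.star_mem_kernel (E.coe_mul_mem_kernel x hk))
      (E.coe_mul_mem_kernel y hk), hsymm, star_mul, MulMemClass.coe_mul, StarMemClass.coe_star]
    noncomm_ring
  · change ((star ((hE.innerSystem hu hk).z : A) * (hE.innerSystem hu hk).α (star x) : A) : B) * u
      = star ((x : B) * u)
    rw [MulMemClass.coe_mul, StarMemClass.coe_star, hα, hz, star_mul, star_mul,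
      StarMemClass.coe_star]
    calc star u * star u * (u * star (x : B) * star u) * u
        = star u * (star u * u) * star (x : B) * (star u * u) := by noncomm_ring
      _ = star u * star (x : B) := by rw [h1, mul_one, mul_one]

/-- An isomorphism `X_α ≅ X_B` is given by a unitary `u` of the kernel with `α = Ad(u)` and
`z = u ^ 2`. -/
theorem CondExp.HasIndex.exists_unitary_of_isomorphic (hE : E.HasIndex 2) {S : InnerSystem A}
    (h : S.bimodule.Isomorphic E.kernelBimodule) :
    ∃ u ∈ unitary B, u ∈ E.kernel ∧ (∀ a : A, (S.α a : B) * u = u * a) ∧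
      ((S.z : A) : B) = u * u := by
  -- The isomorphism is restated with the carriers unfolded to `A` and the kernel. The unitary will
  -- be `ρ 1`, and left linearity gives `ρ a = a (ρ 1)`.
  obtain ⟨ρ, hl, hr, hL, hR, hs⟩ : ∃ ρ : A → E.kernel,
      (∀ a x, (ρ (a * x) : B) = a * (ρ x : B)) ∧ (∀ x a, (ρ (x * S.α a) : B) = ρ x * (a : B)) ∧
      (∀ x y, E ((ρ x : B) * star (ρ y : B)) = x * star y) ∧
      (∀ x y, E (star (ρ x : B) * (ρ y : B)) = S.α.symm (star x * y)) ∧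
      ∀ x, (ρ (star (S.z : A) * S.α (star x)) : B) = star (ρ x : B) := by
    obtain ⟨ρ, hl, hr, hL, hR, hs⟩ := h
    exact ⟨ρ, fun a x => congrArg Subtype.val (hl a x), fun x a => congrArg Subtype.val (hr x a),
      hL, hR, fun x => congrArg Subtype.val (hs x)⟩
  have hρ : ∀ a : A, (ρ a : B) = a * (ρ 1 : B) := fun a => by rw [← hl, mul_one]
  have h2 : (ρ 1 : B) * star (ρ 1 : B) = 1 := by
    rw [← hE.kernel_mul_kernel (ρ 1).2 (E.star_mem_kernel (ρ 1).2), hL, star_one, mul_one,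
      OneMemClass.coe_one]
  have h1 : star (ρ 1 : B) * (ρ 1 : B) = 1 := by
    rw [← hE.kernel_mul_kernel (E.star_mem_kernel (ρ 1).2) (ρ 1).2, hR, star_one, mul_one,
      map_one, OneMemClass.coe_one]
  refine ⟨ρ 1, Unitary.mem_iff.mpr ⟨h1, h2⟩, (ρ 1).2, fun a => ?_, ?_⟩
  · rw [← hr, one_mul, ← hρ]
  -- With `u = ρ 1`, compatibility with the involutions at `1` reads `z⋆ u = u⋆`, whose adjoint is
  -- `u⋆ z = u`.
  · have e := hs 1
    rw [star_one, map_one, mul_one, hρ, StarMemClass.coe_star] at e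
    have e' := congrArg star e
    rw [star_mul, star_star, star_star] at e'
    calc ((S.z : A) : B) = (ρ 1 : B) * (star (ρ 1 : B) * ((S.z : A) : B)) := by
          rw [← mul_assoc, h2, one_mul]
      _ = ρ 1 * ρ 1 := by rw [e']

end Unitary

/-! ## The restricted crossed product -/

section CrossedProduct

open InnerSystem

variable {B : Type u} [CStarAlgebra B] {A : StarSubalgebra ℂ B} [IsClosed (A : Set B)]
  {E : CondExp A}

/-- The homomorphism `f ↦ f(0) + f(1) u` for a unitary `u` that implements the system. -/
noncomputable def InnerSystem.Conv.lift {S : InnerSystem A} {u : B} (hu : u ∈ unitary B)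
    (hα : ∀ a : A, (S.α a : B) * u = u * a) (hz : ((S.z : A) : B) = u * u) : S.Conv →⋆ₐ[ℂ] B where
  toFun f := (f 0 : B) + (f 1 : B) * u
  map_zero' := by simp
  map_one' := by simp
  map_add' f g := by
    simp only [Conv.add_apply, AddMemClass.coe_add, add_mul]
    abel
  map_mul' f g := by
    -- The value at `0` of the product involves `g(-1) = g(1) z`, which matches `u² = z`.
    simp only [Conv.mul_apply, zero_sub, sub_self, Conv.shift_neg_one, map_mul, S.map_z]
    push_cast
    rw [hz]
    calc (f 0 : B) * g 0 + f 1 * (S.α (g 1) * (u * u)) + (f 0 * g 1 + f 1 * S.α (g 0)) * u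
        = (f 0 : B) * g 0 + f 1 * (S.α (g 1) * u) * u + f 0 * g 1 * u + f 1 * (S.α (g 0) * u) := by
          noncomm_ring
      _ = ((f 0 : B) + f 1 * u) * (g 0 + g 1 * u) := by rw [hα, hα]; noncomm_ring
  commutes' r := by
    rw [Algebra.algebraMap_eq_smul_one, Algebra.algebraMap_eq_smul_one]
    simp
  map_star' f := by
    have h1 : star u * u = 1 := (Unitary.mem_iff.mp hu).1
    -- The odd term is `α((f(1) z)⋆) u = u z⋆ f(1)⋆ = u⋆ f(1)⋆ = (f(1) u)⋆`.
    simp only [Conv.star_apply, neg_zero, zpow_zero, zpow_one, StarAlgEquiv.one_apply,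
      Conv.shift_neg_one]
    rw [hα, star_mul, MulMemClass.coe_mul, StarMemClass.coe_star, StarMemClass.coe_star,
      StarMemClass.coe_star, hz, star_mul, star_add, star_mul]
    congr 1
    have h2 : u * star u = 1 := (Unitary.mem_iff.mp hu).2
    rw [mul_assoc (star u), ← mul_assoc, h2, one_mul]

theorem InnerSystem.Conv.lift_apply {S : InnerSystem A} {u : B} (hu : u ∈ unitary B)
    (hα : ∀ a : A, (S.α a : B) * u = u * a) (hz : ((S.z : A) : B) = u * u) (f : S.Conv) :
    Conv.lift hu hα hz f = (f 0 : B) + (f 1 : B) * u := rfl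

/-- Elements of `K(ℤ, A, z)` have arbitrary values at `0` and `1`. -/
theorem InnerSystem.Conv.exists_apply_eq (S : InnerSystem A) (a b : A) :
    ∃ f : S.Conv, f 0 = a ∧ f 1 = b := by
  -- `g` is the canonical odd generator. Division rounds down, so `g(2k + 1) = z ^ (-k)` and in
  -- particular `g(1) = 1`.
  let g : S.Conv := ⟨fun n => if Even n then 0 else ((S.z ^ (-(n / 2)) : unitary A) : A),
    fun n m => by
      have h : Even (n - 2 * m) ↔ Even n := by simp [Int.even_sub]
      by_cases hn : Even n
      · simp [h, hn]
      · simp only [h, hn, if_false]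
        rw [← Submonoid.coe_mul, ← zpow_add, show (n - 2 * m) / 2 = n / 2 - m by omega,
          neg_sub, sub_eq_neg_add]⟩
  have g0 : g 0 = 0 := by simp [g]
  have g1 : g 1 = 1 := by simp [g]
  refine ⟨Conv.single a + Conv.single b * g, ?_, ?_⟩
  · simp [Conv.mul_apply, g0]
  · simp [Conv.mul_apply, g1]

/-- A bijective ⋆-homomorphism onto a C⋆-algebra is a completion for the largest C⋆-seminorm. -/
theorem InnerSystem.isRestrictedCrossedProduct_of_bijective {S : InnerSystem A}
    {ι : S.Conv →⋆ₐ[ℂ] B} (hι : Function.Bijective ι) : S.IsRestrictedCrossedProduct ι := by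
  refine ⟨hι.2.denseRange, fun f => ⟨?_, fun r hr => hr ⟨B, inferInstance, ι, rfl⟩⟩⟩
  rintro _ ⟨C, _, σ, rfl⟩
  let e := StarAlgEquiv.ofBijective ι hι
  -- Every `σ` factors through `B`, where ⋆-homomorphisms are contractive; the bound is attained by
  -- `ι` itself.
  have h := NonUnitalStarAlgHom.norm_apply_le (σ.comp (e.symm : B →⋆ₐ[ℂ] S.Conv)) (ι f)
  have he : e.symm (ι f) = f := e.symm_apply_apply f
  change ‖σ (e.symm (ι f))‖ ≤ _ at h
  rwa [he] at h

theorem CondExp.HasIndex.exists_crossedProduct (hE : E.HasIndex 2) {S : InnerSystem A}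
    (h : S.bimodule.Isomorphic E.kernelBimodule) :
    ∃ ι : S.Conv →⋆ₐ[ℂ] B, S.IsRestrictedCrossedProduct ι ∧
      (∀ a : A, ι (Conv.single a) = a) ∧ ∀ f : S.Conv, E (ι f) = f 0 := by
  obtain ⟨u, hu, hk, hα, hz⟩ := hE.exists_unitary_of_isomorphic h
  obtain ⟨h1, h2⟩ := Unitary.mem_iff.mp hu
  have hEι : ∀ f : S.Conv, E (Conv.lift hu hα hz f) = f 0 := fun f => by
    rw [Conv.lift_apply, map_add, E.apply_coe, E.apply_coe_mul, E.mem_kernel.mp hk, mul_zero,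
      add_zero]
  refine ⟨Conv.lift hu hα hz, isRestrictedCrossedProduct_of_bijective ⟨fun f g hfg => ?_,
    fun b => ?_⟩, fun a => ?_, hEι⟩
  · have h0 : f 0 = g 0 := by rw [← hEι, hfg, hEι]
    refine Conv.ext_two h0 (Subtype.ext ?_)
    rw [Conv.lift_apply, Conv.lift_apply, h0, add_right_inj] at hfg
    rw [← mul_one (f 1 : B), ← h2, ← mul_assoc, hfg, mul_assoc, h2, mul_one]
  -- The kernel is `A u`: the odd part `x` of `b` is `(x u⋆) u`, with `x u⋆` in `A`.
  · obtain ⟨f, hf0, hf1⟩ := Conv.exists_apply_eq S (E b) (E ((b - (E b : B)) * star u))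
    refine ⟨f, ?_⟩
    rw [Conv.lift_apply, hf0, hf1, hE.kernel_mul_kernel (E.sub_apply_mem_kernel b)
      (E.star_mem_kernel hk), mul_assoc, h1, mul_one, add_sub_cancel]
  · rw [Conv.lift_apply, Conv.single_zero, Conv.single_one, ZeroMemClass.coe_zero, zero_mul,
      add_zero]

end CrossedProduct

end IndexTwo

/-! ### The equivalence theorem -/

theorem proposition4p1p2 {B : Type u} [CStarAlgebra B] (A : StarSubalgebra ℂ B)
    [IsClosed (A : Set B)] (E : IndexTwo.CondExp A) (hE : E.HasIndex 2) :
    -- `X_B` and all the `X_α` are involutive `A`-`A`-equivalence bimodules,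
    E.bimodule.IsInvolutive ∧
    (∀ S : IndexTwo.InnerSystem A, S.bimodule.IsInvolutive) ∧
    -- the three conditions are equivalent,
    List.TFAE [
      E.MvNEquivalent E.jones (1 - E.jones),
      ∃ u ∈ unitary B, E.IsQuasiBasis ![1, u] ![1, star u],
      ∃ S : IndexTwo.InnerSystem A, S.bimodule.Isomorphic E.bimodule] ∧
    -- and a system as in the third condition has restricted crossed product `(B, E)`.
    ∀ S : IndexTwo.InnerSystem A, S.bimodule.Isomorphic E.bimodule →
      ∃ ι : S.Conv →⋆ₐ[ℂ] B, S.IsRestrictedCrossedProduct ι ∧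
        (∀ a : A, ι (IndexTwo.InnerSystem.Conv.single a) = a) ∧
        ∀ f : S.Conv, E (ι f) = f 0 := by
  have hiso := hE.kernelBimodule_isomorphic
  refine ⟨hE.kernelBimodule_isInvolutive.of_isomorphic hiso,
    fun S => S.bimodule_isInvolutive, ?_, fun S hS => hE.exists_crossedProduct (hS.trans hiso.symm)⟩
  -- Each condition is compared with the existence of a unitary in the kernel of `E`.
  tfae_have 1 ↔ 2 := hE.mvNEquivalent_iff.trans hE.exists_quasiBasis_iff.symm
  tfae_have 1 → 3 := fun h => by
    obtain ⟨u, hu, hk⟩ := hE.mvNEquivalent_iff.mp h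
    exact ⟨hE.innerSystem hu hk, (hE.innerSystem_isomorphic hu hk).trans hiso⟩
  tfae_have 3 → 1 := fun ⟨S, hS⟩ => by
    obtain ⟨u, hu, hk, -, -⟩ := hE.exists_unitary_of_isomorphic (hS.trans hiso.symm)
    exact hE.mvNEquivalent_iff.mpr ⟨u, hu, hk⟩
  tfae_finish
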